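/- Let $n\ge 1$, let $V=\mathbb{Q}^n$ (row vectors), $V^*=\operatorname{Hom}(V,\mathbb{Q})$ with the dual standard basis $e_1^*,\dots,e_n^*$, and $V_{\mathbb C}=\mathbb{C}^n$. **Trigonometric functions.** For $w=(r,\lambda)\in\mathbb{Q}\times V^*$ put $\varepsilon_w(z)=\exp(2\pi i(\lambda(z)-r))$. Let $\mathcal{R}(V)$ be the ring of meromorphic functions on $V_{\mathbb C}$ generated by all $\varepsilon_w$ and $(1-\varepsilon_w)^{-1}$ with $\lambda\ne0$, and let $\mathcal{E}(V)\subset\mathcal{C}(V)\subset\mathcal{R}(V)^\times$ be the subgroups generated by the $\varepsilon_w$, respectively by the $\varepsilon_w$ and $1-\varepsilon_w$, with $\lambda\neq 0$. **Milnor $K$-groups.** For a commutative ring $A$ let $K^M(A)=\bigoplus_k K^M_k(A)$ be the tensor algebra of the abelian group $A^\times$ modulo the relations $a\otimes b=0$ for $a+b\in\{0,1\}$, and write $\{x_1,\dots,x_k\}\in K_k^M(A)$ for the class of $x_1\otimes\cdots\otimes x_k$. Let $J_k(V)\subset K^M_k(\mathcal{R}(V))$ be the subgroup generated by the symbols $\{x_1,\dots,x_k\}$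 with all $x_i\in\mathcal{C}(V)$ and some $x_i\in\mathcal{E}(V)$. Let $\tilde J(V)$ be the ideal of $K^M(\mathcal{R}(V))$ generated by all $J_k(V)$ and $\{-1\}$, and put $\tilde K_n^M(V)=K_n^M(\mathcal{R}(V))/(\tilde J(V)\cap K_n^M(\mathcal{R}(V)))$. **Distributions.** Let $\mathcal{S}(V)$ be the group of functions $V\to\mathbb{Z}$ that are periodic with respect to some lattice and supported in some lattice; it is generated by the characteristic functions of the sets $a+d\mathbb{Z}^n$, $a\in\mathbb{Q}^n$, $d\in\mathbb{N}$, $d\geq 1$. Put $\operatorname{Dist}(V,M)=\operatorname{Hom}(\mathcal{S}(V),M)$ for an abelian group $M$. **Actions.** $\gamma\in GL_n(\mathbb{Q})$ acts by $(\gamma\cdot f)(x)=f(x\gamma)$ on $\mathcal{S}(V)$, by $(\gamma\cdot\lambda)(x)=\lambda(x\gamma)$ on $V^*$, by $(F|_\gamma)(z)=F(z\gamma^{-1})$ on $\mathcal{R}(V)$, by $\{F_1,\dots,F_n\}|_\gamma=\{F_1|_\gamma,\dots,F_n|_\gamma\}$ on $\tilde K_n^M(V)$, and by $(\mu|_\gamma)(f)=\mu(\gamma\cdot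 f)|_\gamma$ on $\operatorname{Dist}(V,\tilde K_n^M(V))$. **Simplexes.** A tuple $(\lambda_0,\dots,\lambda_k)$ in $V^*$ is in general position if any $m\le n$ of its members (at distinct positions) are linearly independent. Let $C_k(V)$ be the free abelian group on the classes $[\lambda_0,\dots,\lambda_k]$ of such tuples modulo scaling each $\lambda_i$ by a positive rational number, with the boundary map $\partial[\lambda_0,\dots,\lambda_k]=\sum_{i=0}^k(-1)^i[\lambda_0,\dots,\hat\lambda_i,\dots,\lambda_k]$ and the action $\gamma\cdot[\lambda_0,\dots,\lambda_k]=[\gamma\cdot\lambda_0,\dots,\gamma\cdot\lambda_k]$. **Theorem.** 1. There is a homomorphism $\eta:\mathcal{S}(\mathbb{Q})\to\mathcal{C}(\mathbb{Q})$ whose value at the characteristic function of $a+d\mathbb{Z}$ is $1-e^{2\pi i(z-a)/d}$, for all $a,d\in\mathbb{Q}$ with $d>0$. (It is unique, as these functions generate $\mathcal{S}(\mathbb{Q})$.) 2. There is one and only one homomorphism $\xi:C_{n-1}(V)\to\operatorname{Dist}(V,\tilde K_n^M(V))$ with the following property. If $(\lambda_0,\dots,\lambda_{n-1})$ is a basis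 of $V^*$, $\gamma\in GL_n(\mathbb{Q})$ satisfies $\gamma\cdot\lambda_i=e_{i+1}^*$ for $0\le i\le n-1$, and $f\in\mathcal{S}(V)$ satisfies $\gamma\cdot f=f_1\otimes\cdots\otimes f_n$ with $f_1,\dots,f_n\in\mathcal{S}(\mathbb{Q})$, then $$\xi([\lambda_0,\dots,\lambda_{n-1}])(f)=\{\eta(f_1)(z_1),\dots,\eta(f_n)(z_n)\}|_\gamma .$$ 3. $\xi$ is $GL_n(\mathbb{Q})$-invariant: $\xi(\gamma\cdot c)|_\gamma=\xi(c)$ for all $\gamma\in GL_n(\mathbb{Q})$ and $c\in C_{n-1}(V)$. 4. $\xi$ is a cocycle: $\xi\circ\partial=0$ on $C_n(V)$. 5. For $\gamma_1,\dots,\gamma_n\in GL_n(\mathbb{Q})$ put $\Phi_n^{St}(\gamma_1,\dots,\gamma_n)=\xi([\gamma_1\cdot e_1^*,\dots,\gamma_n\cdot e_1^*])$ if $\gamma_1\cdot e_1^*,\dots,\gamma_n\cdot e_1^*$ are linearly independent, and $\Phi_n^{St}(\gamma_1,\dots,\gamma_n)=0$ otherwise. Then $\Phi_n^{St}$ is a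 homogeneous $(n-1)$-cocycle, that is, $\Phi_n^{St}(\gamma\gamma_1,\dots,\gamma\gamma_n)|_\gamma=\Phi_n^{St}(\gamma_1,\dots,\gamma_n)$ and $\sum_{i=0}^n(-1)^i\Phi_n^{St}(\gamma_0,\dots,\hat\gamma_i,\dots,\gamma_n)=0$ for all $\gamma,\gamma_0,\dots,\gamma_n\in GL_n(\mathbb{Q})$. So it defines a class $[\Phi_n^{St}]\in H^{n-1}(GL_n(\mathbb{Q}),\operatorname{Dist}(\mathbb{Q}^n,\tilde K_n^M(V)))$, the cohomology of the complex of homogeneous cochains. -/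

import Mathlib

open scoped Matrix RightActions

namespace StevensCocycle

noncomputable section

/-! ### Vectors, covectors and complex points -/

/-- The rational vector space `V = ℚⁿ` of row vectors. -/
abbrev Vec (n : ℕ) : Type := Fin n → ℚ

/-- The dual space `V* = Hom(V, ℚ)`. -/
abbrev Covec (n : ℕ) : Type := Module.Dual ℚ (Vec n)

/-- The group `GL(V) = GL_n(ℚ)`. -/
abbrev GLQ (n : ℕ) : Type := GL (Fin n) ℚ

/-- The pullback of a covector along right multiplication by a matrix,
`(A · λ)(x) = λ(x A)`. -/
def covecPull {n m : ℕ} (A : Matrix (Fin n) (Fin m) ℚ) (l : Covec m) : Covec n :=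
  l ∘ₗ Matrix.vecMulLinear A

/-- The left action of `GL_n(ℚ)` on covectors, `(γ · λ)(x) = λ(x γ)`. -/
def covecAct {n : ℕ} (g : GLQ n) (l : Covec n) : Covec n :=
  covecPull (g : Matrix (Fin n) (Fin n) ℚ) l

/-- The `ℂ`-linear extension of a covector `λ` to `V_ℂ = ℂⁿ`. -/
def evalC {n : ℕ} (l : Covec n) (z : Fin n → ℂ) : ℂ :=
  ∑ i, ((l (Pi.single i 1) : ℚ) : ℂ) * z i

/-- Right multiplication of a complex row vector by a rational matrix. -/
def mulC {n m : ℕ} (A : Matrix (Fin n) (Fin m) ℚ) (z : Fin n → ℂ) : Fin m → ℂ :=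
  fun j => ∑ i, z i * ((A i j : ℚ) : ℂ)

theorem evalC_covecPull {n m : ℕ} (A : Matrix (Fin n) (Fin m) ℚ) (l : Covec m)
    (z : Fin n → ℂ) : evalC (covecPull A l) z = evalC l (mulC A z) := by
  have key : ∀ i, covecPull A l (Pi.single i 1) = ∑ j, A i j * l (Pi.single j 1) := by
    intro i
    have h1 : covecPull A l (Pi.single i 1) = l (A i) := by
      simp [covecPull, Matrix.vecMulLinear, Matrix.row]
    rw [h1]
    conv_lhs => rw [← LinearMap.sum_single_apply (fun _ => ℚ) (A i)]
    rw [map_sum]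
    refine Finset.sum_congr rfl fun j _ => ?_
    have h2 : (Pi.single j (A i j) : Vec m) = A i j • (Pi.single j (1 : ℚ) : Vec m) := by
      rw [← Pi.single_smul]; simp
    exact (congrArg l h2).trans (by rw [map_smul, smul_eq_mul])
  simp only [evalC, mulC, key, Rat.cast_sum, Rat.cast_mul, Finset.sum_mul, Finset.mul_sum]
  rw [Finset.sum_comm]
  refine Finset.sum_congr rfl fun j _ => Finset.sum_congr rfl fun i _ => ?_
  ring

/-! ### The ring of trigonometric functions -/

/-- The complement in `ℂⁿ` of all rational affine hyperplanes `λ(z) = r`, `λ ≠ 0`. It is dense in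
`ℂⁿ`, and the poles of all functions considered below lie outside of it, so that these meromorphic
functions are faithfully represented by their restrictions to it. -/
def Dom (n : ℕ) : Set (Fin n → ℂ) :=
  {z | ∀ l : Covec n, l ≠ 0 → ∀ r : ℚ, evalC l z ≠ (r : ℂ)}

/-- The function `ε_w(z) = exp(2πi(λ(z) - r))` for `w = (r, λ) ∈ ℚ × V*`. -/
def eps {n : ℕ} (r : ℚ) (l : Covec n) : Dom n → ℂ :=
  fun z => Complex.exp (2 * Real.pi * Complex.I * (evalC l z - (r : ℂ)))

/-- The ring `ℛ(V)` of trigonometric functions, generated by the functions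
`ε_w` and `(1 - ε_w)⁻¹` for `w = (r, λ)`, `λ ≠ 0` (note that `ε_w⁻¹` is again of the form `ε_w`). -/
def TrigRing (n : ℕ) : Subring (Dom n → ℂ) :=
  Subring.closure {F | ∃ (r : ℚ) (l : Covec n), l ≠ 0 ∧
    (F = eps r l ∨ F = (1 - eps r l)⁻¹)}

/-- The group `ℰ(V)` generated by the units `ε_w`, `λ ≠ 0`. -/
def EGroup (n : ℕ) : Subgroup (TrigRing n)ˣ :=
  Subgroup.closure {u | ∃ (r : ℚ) (l : Covec n), l ≠ 0 ∧
    ((u : TrigRing n) : Dom n → ℂ) = eps r l}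

/-- The group `𝒞(V)` generated by the units `ε_w` and `1 - ε_w`, `λ ≠ 0`. -/
def CGroup (n : ℕ) : Subgroup (TrigRing n)ˣ :=
  Subgroup.closure {u | ∃ (r : ℚ) (l : Covec n), l ≠ 0 ∧
    (((u : TrigRing n) : Dom n → ℂ) = eps r l ∨
      ((u : TrigRing n) : Dom n → ℂ) = 1 - eps r l)}

theorem mulC_mem_Dom {n m : ℕ} (A : Matrix (Fin n) (Fin m) ℚ)
    (hA : ∀ l : Covec m, l ≠ 0 → covecPull A l ≠ 0) {z : Fin n → ℂ} (hz : z ∈ Dom n) :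
    mulC A z ∈ Dom m := by
  intro l hl r
  rw [← evalC_covecPull]
  exact hz _ (hA l hl) r

/-- `F ↦ (z ↦ F(z A))` on all functions. -/
def pullFun {n m : ℕ} (A : Matrix (Fin n) (Fin m) ℚ)
    (hA : ∀ l : Covec m, l ≠ 0 → covecPull A l ≠ 0) : (Dom m → ℂ) →+* (Dom n → ℂ) where
  toFun F z := F ⟨mulC A z, mulC_mem_Dom A hA z.2⟩
  map_one' := rfl
  map_mul' _ _ := rfl
  map_zero' := rfl
  map_add' _ _ := rfl

theorem pullFun_eps {n m : ℕ} (A : Matrix (Fin n) (Fin m) ℚ)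
    (hA : ∀ l : Covec m, l ≠ 0 → covecPull A l ≠ 0) (r : ℚ) (l : Covec m) :
    pullFun A hA (eps r l) = eps r (covecPull A l) := by
  funext z
  simp only [pullFun, eps, RingHom.coe_mk, MonoidHom.coe_mk, OneHom.coe_mk, evalC_covecPull]

theorem pullFun_mem {n m : ℕ} (A : Matrix (Fin n) (Fin m) ℚ)
    (hA : ∀ l : Covec m, l ≠ 0 → covecPull A l ≠ 0) (F : TrigRing m) :
    pullFun A hA F ∈ TrigRing n := by
  have h : TrigRing m ≤ (TrigRing n).comap (pullFun A hA) := by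
    refine Subring.closure_le.mpr ?_
    rintro F ⟨r, l, hl, rfl | rfl⟩
    · refine Subring.subset_closure ⟨r, covecPull A l, hA l hl, Or.inl ?_⟩
      exact pullFun_eps A hA r l
    · refine Subring.subset_closure ⟨r, covecPull A l, hA l hl, Or.inr ?_⟩
      rw [← pullFun_eps A hA]
      rfl
  exact h F.2

/-- The pullback `ℛ(ℚᵐ) → ℛ(ℚⁿ)`, `F ↦ (z ↦ F(z A))`. -/
def trigPull {n m : ℕ} (A : Matrix (Fin n) (Fin m) ℚ)
    (hA : ∀ l : Covec m, l ≠ 0 → covecPull A l ≠ 0) : TrigRing m →+* TrigRing n :=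
  ((pullFun A hA).comp (TrigRing m).subtype).codRestrict (TrigRing n) (pullFun_mem A hA)

theorem covecPull_comp {n m k : ℕ} (A : Matrix (Fin n) (Fin m) ℚ) (B : Matrix (Fin m) (Fin k) ℚ)
    (l : Covec k) : covecPull A (covecPull B l) = covecPull (A * B) l := by
  refine LinearMap.ext fun x => ?_
  simp [covecPull, Matrix.vecMul_vecMul]

theorem covecPull_one {n : ℕ} (l : Covec n) :
    covecPull (1 : Matrix (Fin n) (Fin n) ℚ) l = l := by
  refine LinearMap.ext fun x => ?_
  simp [covecPull]

theorem covecAct_one {n : ℕ} (l : Covec n) : covecAct (1 : GLQ n) l = l := covecPull_one l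

theorem covecAct_mul {n : ℕ} (g h : GLQ n) (l : Covec n) :
    covecAct (g * h) l = covecAct g (covecAct h l) := (covecPull_comp _ _ l).symm

theorem covecAct_ne_zero {n : ℕ} (g : GLQ n) (l : Covec n) (hl : l ≠ 0) : covecAct g l ≠ 0 := by
  intro h
  apply hl
  have h2 : covecAct g⁻¹ (covecAct g l) = covecAct g⁻¹ 0 := by rw [h]
  rw [← covecAct_mul, inv_mul_cancel, covecAct_one] at h2
  rw [h2]
  exact LinearMap.zero_comp _

/-- The right action of `GL_n(ℚ)` on `ℛ(V)`, `(F|γ)(z) = F(z γ⁻¹)`. -/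
def trigAct {n : ℕ} (g : GLQ n) : TrigRing n →+* TrigRing n :=
  trigPull ((g⁻¹ : GLQ n) : Matrix (Fin n) (Fin n) ℚ) (covecAct_ne_zero g⁻¹)

theorem coordMatrix_ne_zero {n : ℕ} (i : Fin n) (l : Covec 1) (hl : l ≠ 0) :
    covecPull (Matrix.of fun (j : Fin n) (_ : Fin 1) => if j = i then (1 : ℚ) else 0) l ≠ 0 := by
  intro h
  apply hl
  refine LinearMap.ext fun x => ?_
  have h2 := LinearMap.congr_fun h (Pi.single i (x 0))
  simp only [covecPull, LinearMap.comp_apply, Matrix.vecMulLinear_apply,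
    LinearMap.zero_apply] at h2
  have h3 : (Pi.single i (x 0) : Vec n) ᵥ*
      (Matrix.of fun (j : Fin n) (_ : Fin 1) => if j = i then (1 : ℚ) else 0) = x := by
    funext k
    rw [Subsingleton.elim k 0]
    simp
  rw [h3] at h2
  simpa using h2

/-- The pullback `(e_i^*)^* : ℛ(ℚ) → ℛ(V)`, which views a function `F(z)` of one variable as the
function `F(z_i)` on `ℂⁿ`. -/
def coordPull {n : ℕ} (i : Fin n) : TrigRing 1 →+* TrigRing n :=
  trigPull (Matrix.of fun (j : Fin n) (_ : Fin 1) => if j = i then (1 : ℚ) else 0)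
    (coordMatrix_ne_zero i)

theorem trigAct_apply {n : ℕ} (g : GLQ n) (F : TrigRing n) (z : Dom n) :
    ((trigAct g F : TrigRing n) : Dom n → ℂ) z =
      (F : Dom n → ℂ) ⟨mulC ((g⁻¹ : GLQ n) : Matrix (Fin n) (Fin n) ℚ) z,
        mulC_mem_Dom _ (covecAct_ne_zero g⁻¹) z.2⟩ := rfl

theorem mulC_mulC {n m k : ℕ} (A : Matrix (Fin n) (Fin m) ℚ) (B : Matrix (Fin m) (Fin k) ℚ)
    (z : Fin n → ℂ) : mulC B (mulC A z) = mulC (A * B) z := by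
  funext j
  simp only [mulC, Matrix.mul_apply, Rat.cast_sum, Rat.cast_mul, Finset.sum_mul, Finset.mul_sum]
  rw [Finset.sum_comm]
  refine Finset.sum_congr rfl fun j _ => Finset.sum_congr rfl fun i _ => ?_
  ring

theorem mulC_one {n : ℕ} (z : Fin n → ℂ) : mulC (1 : Matrix (Fin n) (Fin n) ℚ) z = z := by
  funext j
  simp only [mulC, Matrix.one_apply]
  rw [Finset.sum_eq_single j]
  · simp
  · intro i _ hi
    simp [hi]
  · simp

theorem trigAct_one {n : ℕ} : trigAct (1 : GLQ n) = RingHom.id _ := by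
  refine RingHom.ext fun F => Subtype.ext (funext fun z => ?_)
  rw [trigAct_apply]
  refine congrArg (F : Dom n → ℂ) (Subtype.ext ?_)
  simp [mulC_one]

theorem trigAct_mul {n : ℕ} (g h : GLQ n) : trigAct (g * h) = (trigAct h).comp (trigAct g) := by
  refine RingHom.ext fun F => Subtype.ext (funext fun z => ?_)
  rw [RingHom.comp_apply, trigAct_apply, trigAct_apply, trigAct_apply]
  refine congrArg (F : Dom n → ℂ) (Subtype.ext ?_)
  simp only [mulC_mulC, mul_inv_rev, Units.val_mul]

theorem trigAct_EGroup {n : ℕ} (g : GLQ n) (u : (TrigRing n)ˣ) (hu : u ∈ EGroup n) :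
    Units.map (trigAct g : TrigRing n →* TrigRing n) u ∈ EGroup n := by
  have h : EGroup n ≤ (EGroup n).comap (Units.map (trigAct g : TrigRing n →* TrigRing n)) := by
    refine (Subgroup.closure_le _).mpr ?_
    rintro u ⟨r, l, hl, h⟩
    refine Subgroup.subset_closure ⟨r, covecAct g⁻¹ l, covecAct_ne_zero _ l hl, ?_⟩
    rw [covecAct, ← pullFun_eps _ (covecAct_ne_zero g⁻¹), ← h]
    rfl
  exact h hu

theorem trigAct_CGroup {n : ℕ} (g : GLQ n) (u : (TrigRing n)ˣ) (hu : u ∈ CGroup n) :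
    Units.map (trigAct g : TrigRing n →* TrigRing n) u ∈ CGroup n := by
  have h : CGroup n ≤ (CGroup n).comap (Units.map (trigAct g : TrigRing n →* TrigRing n)) := by
    refine (Subgroup.closure_le _).mpr ?_
    rintro u ⟨r, l, hl, h⟩
    refine Subgroup.subset_closure ⟨r, covecAct g⁻¹ l, covecAct_ne_zero _ l hl, ?_⟩
    rw [covecAct, ← pullFun_eps _ (covecAct_ne_zero g⁻¹)]
    refine h.imp (fun h => ?_) (fun h => ?_)
    · rw [← h]; rfl
    · rw [← map_one (pullFun _ (covecAct_ne_zero g⁻¹)), ← map_sub, ← h]; rfl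
  exact h hu

/-! ### Milnor `K`-theory -/

/-- The Steinberg relations `a ⊗ b = 0` for units `a`, `b` with `a + b = 0` or `a + b = 1`. -/
inductive SteinbergRel (A : Type) [CommRing A] :
    TensorAlgebra ℤ (Additive Aˣ) → TensorAlgebra ℤ (Additive Aˣ) → Prop
  | intro (a b : Aˣ) (h : (a : A) + (b : A) = 0 ∨ (a : A) + (b : A) = 1) :
      SteinbergRel A
        (TensorAlgebra.ι ℤ (Additive.ofMul a) * TensorAlgebra.ι ℤ (Additive.ofMul b)) 0

/-- The Milnor `K`-ring `K^M(A)`: the tensor algebra of the abelian group `Aˣ` modulo the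
Steinberg relations. -/
def MilnorK (A : Type) [CommRing A] : Type := RingQuot (SteinbergRel A)

instance (A : Type) [CommRing A] : Ring (MilnorK A) :=
  inferInstanceAs (Ring (RingQuot (SteinbergRel A)))

/-- The quotient map from the tensor algebra. -/
def MilnorK.mk (A : Type) [CommRing A] : TensorAlgebra ℤ (Additive Aˣ) →+* MilnorK A :=
  RingQuot.mkRingHom (SteinbergRel A)

/-- The map `a ↦ {a}` from `Aˣ` to `K^M(A)`, as an additive homomorphism. -/
def MilnorK.bracketHom (A : Type) [CommRing A] : Additive Aˣ →+ MilnorK A :=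
  (MilnorK.mk A).toAddMonoidHom.comp (TensorAlgebra.ι ℤ).toAddMonoidHom

/-- The symbol `{x₁, …, x_k}`. -/
def MilnorK.symbol {A : Type} [CommRing A] {k : ℕ} (x : Fin k → Aˣ) : MilnorK A :=
  (List.ofFn fun i => MilnorK.bracketHom A (Additive.ofMul (x i))).prod

/-- The Milnor `K`-group `K_k^M(A)`: the degree `k` part of the ring `K^M(A)`. -/
def MilnorK.degree (A : Type) [CommRing A] (k : ℕ) : AddSubgroup (MilnorK A) :=
  AddSubgroup.closure (Set.range (MilnorK.symbol : (Fin k → Aˣ) → MilnorK A))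

theorem MilnorK.bracket_mul {A : Type} [CommRing A] (a b : Aˣ)
    (h : (a : A) + (b : A) = 0 ∨ (a : A) + (b : A) = 1) :
    MilnorK.bracketHom A (Additive.ofMul a) * MilnorK.bracketHom A (Additive.ofMul b) = 0 := by
  have := RingQuot.mkRingHom_rel (SteinbergRel.intro a b h)
  rw [map_mul, map_zero] at this
  exact this

/-- The ring homomorphism `K^M(A) → K^M(B)` induced by a ring homomorphism `A → B`. -/
def MilnorK.map {A B : Type} [CommRing A] [CommRing B] (f : A →+* B) : MilnorK A →+* MilnorK B :=
  RingQuot.lift ⟨(TensorAlgebra.lift ℤ ((MilnorK.bracketHom B).comp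
      (MonoidHom.toAdditive (Units.map (f : A →* B)))).toIntLinearMap).toRingHom, by
    rintro _ _ ⟨a, b, h⟩
    have h' : ((Units.map (f : A →* B) a : Bˣ) : B) + (Units.map (f : A →* B) b : Bˣ) = 0 ∨
        ((Units.map (f : A →* B) a : Bˣ) : B) + (Units.map (f : A →* B) b : Bˣ) = 1 := by
      refine h.imp (fun h => ?_) (fun h => ?_)
      · simpa using congrArg f h
      · simpa using congrArg f h
    simpa using MilnorK.bracket_mul _ _ h'⟩

theorem MilnorK.map_bracket {A B : Type} [CommRing A] [CommRing B] (f : A →+* B) (a : Aˣ) :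
    MilnorK.map f (MilnorK.bracketHom A (Additive.ofMul a)) =
      MilnorK.bracketHom B (Additive.ofMul (Units.map (f : A →* B) a)) := by
  have h : MilnorK.bracketHom A (Additive.ofMul a) =
    RingQuot.mkRingHom (SteinbergRel A) (TensorAlgebra.ι ℤ (Additive.ofMul a)) := rfl
  rw [h, MilnorK.map]
  erw [RingQuot.lift_mkRingHom_apply]
  simp

theorem MilnorK.map_symbol {A B : Type} [CommRing A] [CommRing B] (f : A →+* B) {k : ℕ}
    (x : Fin k → Aˣ) :
    MilnorK.map f (MilnorK.symbol x) =
      MilnorK.symbol (fun i => Units.map (f : A →* B) (x i)) := by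
  rw [MilnorK.symbol, map_list_prod, List.map_ofFn, MilnorK.symbol]
  congr 2
  funext i
  exact MilnorK.map_bracket f (x i)

theorem MilnorK.map_degree {A B : Type} [CommRing A] [CommRing B] (f : A →+* B) {k : ℕ}
    {x : MilnorK A} (hx : x ∈ MilnorK.degree A k) : MilnorK.map f x ∈ MilnorK.degree B k := by
  have h : MilnorK.degree A k ≤
      (MilnorK.degree B k).comap (MilnorK.map f).toAddMonoidHom := by
    refine (AddSubgroup.closure_le _).mpr ?_
    rintro _ ⟨x, rfl⟩
    refine AddSubgroup.subset_closure ⟨_, (MilnorK.map_symbol f x).symm⟩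
  exact h hx

/-! ### The quotient of the Milnor `K`-groups of `ℛ(V)` -/

/-- The subgroup `J_k(V)` of `K_k^M(V)`, generated by the symbols `{x₁, …, x_k}` with all
`x_i ∈ 𝒞(V)` and at least one `x_i ∈ ℰ(V)`. (It is `0` for `k = 0`.) -/
def JGroup (n k : ℕ) : AddSubgroup (MilnorK (TrigRing n)) :=
  AddSubgroup.closure {s | ∃ x : Fin k → (TrigRing n)ˣ,
    (∀ i, x i ∈ CGroup n) ∧ (∃ i, x i ∈ EGroup n) ∧ s = MilnorK.symbol x}

/-- The ideal `J̃(V)` of `K^M(V)` generated by all `J_k(V)` and `{-1}`. -/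
def JTilde (n : ℕ) : TwoSidedIdeal (MilnorK (TrigRing n)) :=
  TwoSidedIdeal.span ({s | ∃ k, s ∈ JGroup n k} ∪
    {MilnorK.bracketHom (TrigRing n) (Additive.ofMul (-1))})

/-- `J̃_k(V) = J̃(V) ∩ K_k^M(V)`, as a subgroup of `K_k^M(V)`. -/
def JTildeDeg (n k : ℕ) : AddSubgroup (MilnorK.degree (TrigRing n) k) where
  carrier := {x | (x : MilnorK (TrigRing n)) ∈ JTilde n}
  zero_mem' := (JTilde n).zero_mem
  add_mem' := fun ha hb => (JTilde n).add_mem ha hb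
  neg_mem' := fun ha => (JTilde n).neg_mem ha

/-- The group `K̃_k^M(V) = K_k^M(V) / J̃_k(V)`. -/
def KTilde (n k : ℕ) : Type := MilnorK.degree (TrigRing n) k ⧸ JTildeDeg n k

instance (n k : ℕ) : AddCommGroup (KTilde n k) :=
  inferInstanceAs (AddCommGroup (MilnorK.degree (TrigRing n) k ⧸ JTildeDeg n k))

/-- The class of the symbol `{x₁, …, x_k}` in `K̃_k^M(V)`. -/
def KTilde.symbol {n k : ℕ} (x : Fin k → (TrigRing n)ˣ) : KTilde n k :=
  QuotientAddGroup.mk' (JTildeDeg n k)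
    ⟨MilnorK.symbol x, AddSubgroup.subset_closure ⟨x, rfl⟩⟩

theorem map_trigAct_JTilde {n : ℕ} (g : GLQ n) {s : MilnorK (TrigRing n)} (hs : s ∈ JTilde n) :
    MilnorK.map (trigAct g) s ∈ JTilde n := by
  have h : JTilde n ≤ (JTilde n).comap (MilnorK.map (trigAct g)) := by
    refine TwoSidedIdeal.span_le.mpr ?_
    rintro s (⟨k, hs⟩ | rfl)
    · have hJ : JGroup n k ≤ (JGroup n k).comap (MilnorK.map (trigAct g)).toAddMonoidHom := by
        refine (AddSubgroup.closure_le _).mpr ?_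
        rintro _ ⟨x, hx, ⟨i, hi⟩, rfl⟩
        exact AddSubgroup.subset_closure ⟨_, fun j => trigAct_CGroup g _ (hx j),
          ⟨i, trigAct_EGroup g _ hi⟩, MilnorK.map_symbol _ x⟩
      exact (TwoSidedIdeal.mem_comap _).mpr (TwoSidedIdeal.subset_span (Or.inl ⟨k, hJ hs⟩))
    · refine (TwoSidedIdeal.mem_comap _).mpr (TwoSidedIdeal.subset_span (Or.inr ?_))
      rw [MilnorK.map_bracket]
      have h1 : Units.map (trigAct g : TrigRing n →* TrigRing n) (-1) = -1 := by
        ext1; simp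
      rw [h1]
      rfl
  exact (TwoSidedIdeal.mem_comap _).mp (h hs)

/-- The map `{F₁, …, F_k} ↦ {F₁|γ, …, F_k|γ}` on `K_k^M(V)`. -/
def degreeAct {n : ℕ} (k : ℕ) (g : GLQ n) :
    MilnorK.degree (TrigRing n) k →+ MilnorK.degree (TrigRing n) k :=
  ((MilnorK.map (trigAct g)).toAddMonoidHom.comp
    (MilnorK.degree (TrigRing n) k).subtype).codRestrict _ fun x => MilnorK.map_degree _ x.2

/-- The map `{F₁, …, F_k} ↦ {F₁|γ, …, F_k|γ}` on `K̃_k^M(V)`. -/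
def KTilde.act {n : ℕ} (k : ℕ) (g : GLQ n) : KTilde n k →+ KTilde n k :=
  QuotientAddGroup.map (JTildeDeg n k) (JTildeDeg n k) (degreeAct k g)
    fun _ hx => map_trigAct_JTilde g hx

theorem KTilde.act_symbol {n k : ℕ} (g : GLQ n) (x : Fin k → (TrigRing n)ˣ) :
    KTilde.act k g (KTilde.symbol x) =
      KTilde.symbol fun i => Units.map (trigAct g : TrigRing n →* TrigRing n) (x i) := by
  refine congrArg (QuotientAddGroup.mk' (JTildeDeg n k)) (Subtype.ext ?_)
  exact MilnorK.map_symbol _ x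

theorem KTilde.hom_ext {n k : ℕ} {M : Type} [AddCommGroup M] {f g : KTilde n k →+ M}
    (h : ∀ x : Fin k → (TrigRing n)ˣ, f (KTilde.symbol x) = g (KTilde.symbol x)) : f = g := by
  have key : ∀ (s : MilnorK (TrigRing n)) (hs : s ∈ MilnorK.degree (TrigRing n) k),
      f (QuotientAddGroup.mk' (JTildeDeg n k) ⟨s, hs⟩) =
        g (QuotientAddGroup.mk' (JTildeDeg n k) ⟨s, hs⟩) := by
    intro s hs
    refine AddSubgroup.closure_induction
      (p := fun s hs => f (QuotientAddGroup.mk' (JTildeDeg n k) ⟨s, hs⟩) =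
        g (QuotientAddGroup.mk' (JTildeDeg n k) ⟨s, hs⟩)) ?_ ?_ ?_ ?_ hs
    · rintro _ ⟨x, rfl⟩
      exact h x
    · exact (map_zero f).trans (map_zero g).symm
    · intro a b ha hb h1 h2
      exact (map_add f _ _).trans ((congrArg₂ (· + ·) h1 h2).trans (map_add g _ _).symm)
    · intro a ha h1
      exact (map_neg f _).trans ((congrArg Neg.neg h1).trans (map_neg g _).symm)
  refine AddMonoidHom.ext fun x => ?_
  obtain ⟨⟨s, hs⟩, rfl⟩ := QuotientAddGroup.mk'_surjective (JTildeDeg n k) x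
  exact key s hs

/-- The right `GL_n(ℚ)`-module structure of `K̃_k^M(V)`; here `x <• γ` is written `x|γ` in
the literature. -/
instance (n k : ℕ) : DistribMulAction (GLQ n)ᵐᵒᵖ (KTilde n k) where
  smul g x := KTilde.act k g.unop x
  one_smul x := by
    have h : KTilde.act k (1 : GLQ n) = AddMonoidHom.id (KTilde n k) := by
      refine KTilde.hom_ext fun x => ?_
      rw [KTilde.act_symbol, trigAct_one]
      rfl
    exact DFunLike.congr_fun h x
  mul_smul g h x := by
    have h : KTilde.act k (h.unop * g.unop) =
        (KTilde.act k g.unop).comp (KTilde.act k h.unop) := by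
      refine KTilde.hom_ext fun x => ?_
      rw [AddMonoidHom.comp_apply, KTilde.act_symbol, KTilde.act_symbol, KTilde.act_symbol,
        trigAct_mul]
      rfl
    exact DFunLike.congr_fun h x
  smul_zero g := map_zero (KTilde.act k g.unop)
  smul_add g := map_add (KTilde.act k g.unop)

/-! ### Test functions and distributions -/

/-- The group `𝒮(V)` of locally constant functions `V → ℤ` with bounded support for the lattice
topology: the functions that are periodic with respect to some lattice and are supported in some
lattice. It is enough to consider the lattices `d ℤⁿ` and `N⁻¹ ℤⁿ`. -/
def TestFun (n : ℕ) : AddSubgroup (Vec n → ℤ) where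
  carrier := {f |
    (∃ d : ℕ, 0 < d ∧ ∀ (x : Vec n) (v : Fin n → ℤ), f (x + fun i => (d : ℚ) * (v i : ℚ)) = f x) ∧
    (∃ N : ℕ, 0 < N ∧ ∀ x : Vec n, f x ≠ 0 → ∃ v : Fin n → ℤ, ∀ i, (N : ℚ) * x i = (v i : ℚ))}
  zero_mem' := ⟨⟨1, one_pos, fun _ _ => rfl⟩, ⟨1, one_pos, fun _ h => absurd rfl h⟩⟩
  add_mem' := by
    rintro f g ⟨⟨d, hd, hf⟩, N, hN, hf'⟩ ⟨⟨e, he, hg⟩, M, hM, hg'⟩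
    refine ⟨⟨d * e, Nat.mul_pos hd he, fun x v => ?_⟩, ⟨N * M, Nat.mul_pos hN hM, fun x hx => ?_⟩⟩
    · have h1 := hf x (fun i => (e : ℤ) * v i)
      have h2 := hg x (fun i => (d : ℤ) * v i)
      have e1 : (fun i => (d : ℚ) * (((e : ℤ) * v i : ℤ) : ℚ)) =
          fun i => ((d * e : ℕ) : ℚ) * (v i : ℚ) := by
        funext i; push_cast; ring
      have e2 : (fun i => (e : ℚ) * (((d : ℤ) * v i : ℤ) : ℚ)) =
          fun i => ((d * e : ℕ) : ℚ) * (v i : ℚ) := by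
        funext i; push_cast; ring
      rw [e1] at h1
      rw [e2] at h2
      rw [Pi.add_apply, h1, h2, Pi.add_apply]
    · by_cases h : f x = 0
      · have hg0 : g x ≠ 0 := by
          intro h0; apply hx; rw [Pi.add_apply, h, h0]; rfl
        obtain ⟨v, hv⟩ := hg' x hg0
        refine ⟨fun i => (N : ℤ) * v i, fun i => ?_⟩
        push_cast
        rw [← hv i]; ring
      · obtain ⟨v, hv⟩ := hf' x h
        refine ⟨fun i => (M : ℤ) * v i, fun i => ?_⟩
        push_cast
        rw [← hv i]; ring
  neg_mem' := by
    rintro f ⟨⟨d, hd, hf⟩, N, hN, hf'⟩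
    refine ⟨⟨d, hd, fun x v => ?_⟩, ⟨N, hN, fun x hx => hf' x ?_⟩⟩
    · rw [Pi.neg_apply, hf x v, Pi.neg_apply]
    · intro h; apply hx; rw [Pi.neg_apply, h]; rfl

theorem exists_clear_denoms {ι : Type} [Fintype ι] (a : ι → ℚ) :
    ∃ D : ℕ, 0 < D ∧ ∀ i, ∃ b : ℤ, (D : ℚ) * a i = (b : ℚ) := by
  classical
  refine ⟨∏ i, (a i).den, Finset.prod_pos fun i _ => (a i).den_pos, fun i => ?_⟩
  refine ⟨(∏ j ∈ Finset.univ.erase i, ((a j).den : ℤ)) * (a i).num, ?_⟩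
  rw [← Finset.mul_prod_erase Finset.univ _ (Finset.mem_univ i)]
  push_cast
  have h := Rat.mul_den_eq_num (a i)
  calc ((a i).den : ℚ) * (∏ j ∈ Finset.univ.erase i, ((a j).den : ℚ)) * a i
      = (∏ j ∈ Finset.univ.erase i, ((a j).den : ℚ)) * (a i * (a i).den) := by ring
    _ = _ := by rw [h]

theorem testFun_act_mem {n : ℕ} (g : GLQ n) (f : TestFun n) :
    (fun x : Vec n => (f : Vec n → ℤ) (x ᵥ* (g : Matrix (Fin n) (Fin n) ℚ))) ∈ TestFun n := by
  obtain ⟨f, ⟨d, hd, hf⟩, N, hN, hf'⟩ := f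
  obtain ⟨D, hD, hb⟩ := exists_clear_denoms
    (fun p : Fin n × Fin n => (g : Matrix (Fin n) (Fin n) ℚ) p.1 p.2)
  choose b hb using hb
  obtain ⟨E, hE, hc⟩ := exists_clear_denoms
    (fun p : Fin n × Fin n => ((g⁻¹ : GLQ n) : Matrix (Fin n) (Fin n) ℚ) p.1 p.2)
  choose c hc using hc
  refine ⟨⟨d * D, Nat.mul_pos hd hD, fun x v => ?_⟩, ⟨N * E, Nat.mul_pos hN hE, fun x hx => ?_⟩⟩
  · have h1 := hf (x ᵥ* (g : Matrix (Fin n) (Fin n) ℚ)) (fun j => ∑ i, v i * b (i, j))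
    have h2 : (x + fun i => ((d * D : ℕ) : ℚ) * (v i : ℚ)) ᵥ* (g : Matrix (Fin n) (Fin n) ℚ) =
        x ᵥ* (g : Matrix (Fin n) (Fin n) ℚ) +
          fun j => (d : ℚ) * ((∑ i, v i * b (i, j) : ℤ) : ℚ) := by
      rw [Matrix.add_vecMul]
      congr 1
      funext j
      simp only [Matrix.vecMul, dotProduct]
      push_cast
      rw [Finset.mul_sum]
      refine Finset.sum_congr rfl fun i _ => ?_
      rw [← hb (i, j)]
      ring
    exact (congrArg f h2).trans h1
  · obtain ⟨v, hv⟩ := hf' _ hx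
    refine ⟨fun j => ∑ i, v i * c (i, j), fun j => ?_⟩
    have h1 : x = (x ᵥ* (g : Matrix (Fin n) (Fin n) ℚ)) ᵥ*
        ((g⁻¹ : GLQ n) : Matrix (Fin n) (Fin n) ℚ) := by
      rw [Matrix.vecMul_vecMul, ← Units.val_mul, mul_inv_cancel, Units.val_one, Matrix.vecMul_one]
    have h2 : x j = ∑ i, (x ᵥ* (g : Matrix (Fin n) (Fin n) ℚ)) i *
        ((g⁻¹ : GLQ n) : Matrix (Fin n) (Fin n) ℚ) i j := congrFun h1 j
    rw [h2, Finset.mul_sum]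
    simp only [Nat.cast_mul, Int.cast_sum, Int.cast_mul]
    refine Finset.sum_congr rfl fun i _ => ?_
    rw [← hv i, ← hc (i, j)]
    exact mul_mul_mul_comm _ _ _ _

/-- The left action of `GL_n(ℚ)` on test functions, `(γ · f)(x) = f(x γ)`. -/
def TestFun.act {n : ℕ} (g : GLQ n) : TestFun n →+ TestFun n where
  toFun f := ⟨fun x => (f : Vec n → ℤ) (x ᵥ* (g : Matrix (Fin n) (Fin n) ℚ)), testFun_act_mem g f⟩
  map_zero' := rfl
  map_add' _ _ := rfl

open Classical in
theorem latticeIndicator_mem (a d : ℚ) (hd : 0 < d) :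
    (fun x : Vec 1 => if ∃ k : ℤ, x 0 = a + d * k then (1 : ℤ) else 0) ∈ TestFun 1 := by
  refine ⟨⟨d.num.natAbs, Int.natAbs_pos.mpr (Rat.num_pos.mpr hd).ne', fun x v => ?_⟩,
    ⟨a.den * d.den, Nat.mul_pos a.den_pos d.den_pos, fun x hx => ?_⟩⟩
  · have h1 : ((d.num.natAbs : ℕ) : ℚ) = d * d.den := by
      rw [Rat.mul_den_eq_num, ← Int.cast_natCast, Int.natCast_natAbs,
        abs_of_pos (Rat.num_pos.mpr hd)]
    refine if_congr ⟨?_, ?_⟩ rfl rfl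
    · rintro ⟨k, hk⟩
      refine ⟨k - d.den * v 0, ?_⟩
      rw [Pi.add_apply, h1] at hk
      push_cast
      linear_combination hk
    · rintro ⟨k, hk⟩
      refine ⟨k + d.den * v 0, ?_⟩
      rw [Pi.add_apply, h1]
      push_cast
      linear_combination hk
  · have hx' : ∃ k : ℤ, x 0 = a + d * k := by
      by_contra h
      exact hx (if_neg h)
    obtain ⟨k, hk⟩ := hx'
    refine ⟨fun _ => d.den * a.num + a.den * d.num * k, fun i => ?_⟩
    rw [Subsingleton.elim i 0, hk]
    push_cast
    have ha := Rat.mul_den_eq_num a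
    have hd' := Rat.mul_den_eq_num d
    rw [← ha, ← hd']
    ring

open Classical in
/-- The characteristic function of `a + d ℤ ⊂ ℚ`, for `d > 0`. -/
def latticeIndicator (a d : ℚ) (hd : 0 < d) : TestFun 1 :=
  ⟨fun x => if ∃ k : ℤ, x 0 = a + d * k then 1 else 0, latticeIndicator_mem a d hd⟩

theorem tensor_mem {n : ℕ} (f : Fin n → TestFun 1) :
    (fun x : Vec n => ∏ i, (f i : Vec 1 → ℤ) (fun _ => x i)) ∈ TestFun n := by
  have hf : ∀ i, ∃ d : ℕ, 0 < d ∧ ∀ (x : Vec 1) (v : Fin 1 → ℤ),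
    (f i : Vec 1 → ℤ) (x + fun i => (d : ℚ) * (v i : ℚ)) = (f i : Vec 1 → ℤ) x := fun i => (f i).2.1
  have hf' : ∀ i, ∃ N : ℕ, 0 < N ∧ ∀ x : Vec 1, (f i : Vec 1 → ℤ) x ≠ 0 →
    ∃ v : Fin 1 → ℤ, ∀ i, (N : ℚ) * x i = (v i : ℚ) := fun i => (f i).2.2
  choose d hd hper using hf
  choose N hN hsup using hf'
  refine ⟨⟨∏ i, d i, Finset.prod_pos fun i _ => hd i, fun x v => ?_⟩,
    ⟨∏ i, N i, Finset.prod_pos fun i _ => hN i, fun x hx => ?_⟩⟩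
  · refine Finset.prod_congr rfl fun i _ => ?_
    have h := hper i (fun _ => x i) (fun _ => (∏ j ∈ Finset.univ.erase i, (d j : ℤ)) * v i)
    rw [← h]
    refine congrArg (f i : Vec 1 → ℤ) (funext fun _ => ?_)
    simp only [Pi.add_apply]
    rw [← Finset.mul_prod_erase Finset.univ d (Finset.mem_univ i)]
    push_cast
    ring
  · have h : ∀ i, ∃ v : ℤ, (N i : ℚ) * x i = (v : ℚ) := by
      intro i
      obtain ⟨v, hv⟩ := hsup i (fun _ => x i) (Finset.prod_ne_zero_iff.mp hx i (Finset.mem_univ i))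
      exact ⟨v 0, hv 0⟩
    choose v hv using h
    refine ⟨fun i => (∏ j ∈ Finset.univ.erase i, (N j : ℤ)) * v i, fun i => ?_⟩
    rw [← Finset.mul_prod_erase Finset.univ N (Finset.mem_univ i)]
    push_cast
    rw [← hv i]
    ring

/-- The factorisable test function `f₁ ⊗ ⋯ ⊗ f_n : (x₁, …, x_n) ↦ f₁(x₁) ⋯ f_n(x_n)`. -/
def tensor {n : ℕ} (f : Fin n → TestFun 1) : TestFun n :=
  ⟨fun x => ∏ i, (f i : Vec 1 → ℤ) (fun _ => x i), tensor_mem f⟩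

/-- The group `Dist(V, M) = Hom(𝒮(V), M)` of distributions on `V = ℚⁿ` with values in `M`. -/
def Distr (n : ℕ) (M : Type) [AddCommGroup M] : Type := TestFun n →+ M

instance (n : ℕ) (M : Type) [AddCommGroup M] : AddCommGroup (Distr n M) :=
  inferInstanceAs (AddCommGroup (TestFun n →+ M))

instance (n : ℕ) (M : Type) [AddCommGroup M] : FunLike (Distr n M) (TestFun n) M :=
  inferInstanceAs (FunLike (TestFun n →+ M) (TestFun n) M)

instance (n : ℕ) (M : Type) [AddCommGroup M] : AddMonoidHomClass (Distr n M) (TestFun n) M :=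
  inferInstanceAs (AddMonoidHomClass (TestFun n →+ M) (TestFun n) M)

/-- `(μ|γ)(f) = (μ(γ · f))|γ`. -/
def Distr.act {n : ℕ} {M : Type} [AddCommGroup M] [DistribMulAction (GLQ n)ᵐᵒᵖ M] (g : GLQ n)
    (μ : Distr n M) : Distr n M :=
  AddMonoidHom.mk' (fun f => μ (TestFun.act g f) <• g) fun a b => by
    rw [map_add, map_add, smul_add]

theorem Distr.act_apply {n : ℕ} {M : Type} [AddCommGroup M] [DistribMulAction (GLQ n)ᵐᵒᵖ M]
    (g : GLQ n) (μ : Distr n M) (f : TestFun n) :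
    Distr.act g μ f = μ (TestFun.act g f) <• g := rfl

/-- The right `GL_n(ℚ)`-module structure `(μ|γ)(f) = (μ(γ · f))|γ` of `Dist(V, M)`, for a right
`GL_n(ℚ)`-module `M`. -/
instance (n : ℕ) (M : Type) [AddCommGroup M] [DistribMulAction (GLQ n)ᵐᵒᵖ M] :
    DistribMulAction (GLQ n)ᵐᵒᵖ (Distr n M) where
  smul g μ := Distr.act g.unop μ
  one_smul μ := by
    refine DFunLike.ext _ _ fun f => ?_
    have h : TestFun.act (1 : GLQ n) f = f := by
      refine Subtype.ext (funext fun x => ?_)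
      simp [TestFun.act]
    have h2 : Distr.act (1 : GLQ n) μ f = μ f := by
      rw [Distr.act_apply, h, MulOpposite.op_one, one_smul]
    exact h2
  mul_smul g h μ := by
    refine DFunLike.ext _ _ fun f => ?_
    have h1 : TestFun.act (h.unop * g.unop) f = TestFun.act h.unop (TestFun.act g.unop f) := by
      refine Subtype.ext (funext fun x => ?_)
      simp [TestFun.act, Matrix.vecMul_vecMul]
    have h2 : Distr.act (h.unop * g.unop) μ f = Distr.act g.unop (Distr.act h.unop μ) f := by
      rw [Distr.act_apply, Distr.act_apply, Distr.act_apply, h1, MulOpposite.op_mul, mul_smul]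
    exact h2
  smul_zero g := by
    refine DFunLike.ext _ _ fun f => ?_
    exact smul_zero (A := M) g
  smul_add g μ ν := by
    refine DFunLike.ext _ _ fun f => ?_
    exact smul_add (A := M) g _ _

/-! ### Simplexes and their cochains -/

/-- A tuple of covectors on `ℚⁿ` is in general position if any `m ≤ n` of its members (at distinct
positions) are linearly independent. -/
def GeneralPosition {n k : ℕ} (l : Fin k → Covec n) : Prop :=
  ∀ s : Finset (Fin k), s.card ≤ n → LinearIndependent ℚ fun i : s => l i

/-- The set `(V*)^{k+1}_{ng}`. -/
def NGTuple (n k : ℕ) : Type := {l : Fin (k + 1) → Covec n // GeneralPosition l}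

/-- Two tuples are equivalent if they are in the same orbit of `(ℚ⁺)^{k+1}`. -/
instance NGTuple.setoid (n k : ℕ) : Setoid (NGTuple n k) where
  r l l' := ∃ b : Fin (k + 1) → ℚ, (∀ i, 0 < b i) ∧ ∀ i, l'.1 i = b i • l.1 i
  iseqv :=
    { refl := fun l => ⟨fun _ => 1, fun _ => one_pos, fun i => (one_smul ℚ _).symm⟩
      symm := by
        rintro l l' ⟨b, hb, h⟩
        refine ⟨fun i => (b i)⁻¹, fun i => inv_pos.mpr (hb i), fun i => ?_⟩
        rw [h i, smul_smul, inv_mul_cancel₀ (hb i).ne', one_smul]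
      trans := by
        rintro l l' l'' ⟨b, hb, h⟩ ⟨c, hc, h'⟩
        refine ⟨fun i => c i * b i, fun i => mul_pos (hc i) (hb i), fun i => ?_⟩
        rw [h' i, h i, smul_smul] }

/-- The set `(V*)^{k+1}_{ng} / (ℚ⁺)^{k+1}` of `k`-simplexes. -/
def Simplex (n k : ℕ) : Type := Quotient (NGTuple.setoid n k)

/-- The simplex `[λ₀, …, λ_k]`. -/
def simplex {n k : ℕ} (l : Fin (k + 1) → Covec n) (h : GeneralPosition l) : Simplex n k :=
  Quotient.mk (NGTuple.setoid n k) ⟨l, h⟩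

theorem GeneralPosition.comp {n k k' : ℕ} {l : Fin k → Covec n} (h : GeneralPosition l)
    (e : Fin k' ↪ Fin k) : GeneralPosition fun i => l (e i) := by
  intro s hs
  have h1 := h (s.map e) (by rwa [Finset.card_map])
  exact h1.comp (fun i : s => (⟨e i, Finset.mem_map_of_mem e i.2⟩ : (s.map e : Finset _)))
    fun i j hij => Subtype.ext (e.injective (congrArg Subtype.val hij))

theorem GeneralPosition.act {n k : ℕ} {l : Fin k → Covec n} (h : GeneralPosition l)
    (g : GLQ n) : GeneralPosition fun i => covecAct g (l i) := by
  intro s hs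
  have h1 := h s hs
  have h2 : LinearIndependent ℚ
      ((LinearMap.lcomp ℚ ℚ (Matrix.vecMulLinear (g : Matrix (Fin n) (Fin n) ℚ))) ∘
        fun i : s => l i) := by
    refine h1.map' _ (LinearMap.ker_eq_bot'.mpr fun m hm => ?_)
    by_contra h0
    exact covecAct_ne_zero g m h0 hm
  exact h2

/-- The face `[λ₀, …, λ̂_i, …, λ_{k+1}]`. -/
def Simplex.face {n k : ℕ} (i : Fin (k + 2)) : Simplex n (k + 1) → Simplex n k :=
  Quotient.map' (fun l => ⟨fun j => l.1 (i.succAbove j), l.2.comp (Fin.succAboveEmb i)⟩) <| by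
    rintro l l' ⟨b, hb, h⟩
    exact ⟨fun j => b (i.succAbove j), fun j => hb _, fun j => h _⟩

/-- The left action `γ · [λ₀, …, λ_k] = [γ · λ₀, …, γ · λ_k]`. -/
def Simplex.act {n k : ℕ} (g : GLQ n) : Simplex n k → Simplex n k :=
  Quotient.map' (fun l => ⟨fun j => covecAct g (l.1 j), l.2.act g⟩) <| by
    rintro l l' ⟨b, hb, h⟩
    refine ⟨b, hb, fun j => ?_⟩
    change covecAct g (l'.1 j) = b j • covecAct g (l.1 j)
    rw [h j]
    exact LinearMap.smul_comp _ _ _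

/-- The group `C_k(V)`: the free abelian group on the `k`-simplexes. -/
abbrev Chain (n k : ℕ) : Type := FreeAbelianGroup (Simplex n k)

/-- The boundary map `∂ : C_{k+1}(V) → C_k(V)`. -/
def boundary (n k : ℕ) : Chain n (k + 1) →+ Chain n k :=
  FreeAbelianGroup.lift fun σ =>
    ∑ i : Fin (k + 2), (-1 : ℤ) ^ (i : ℕ) • FreeAbelianGroup.of (Simplex.face i σ)

/-- The left action of `GL_n(ℚ)` on `C_k(V)`. -/
def Chain.act {n k : ℕ} (g : GLQ n) : Chain n k →+ Chain n k :=
  FreeAbelianGroup.map (Simplex.act g)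

/-! ### Homogeneous group cohomology with values in a right module -/

/-- The group `C^k(G, M)` of homogeneous `k`-cochains: the functions `f : G^{k+1} → M` with
`f|γ = f`, where `(f|γ)(σ₀, …, σ_k) = f(γσ₀, …, γσ_k)|γ`. -/
def HomCochain (G M : Type) [Group G] [AddCommGroup M] [DistribMulAction Gᵐᵒᵖ M] (k : ℕ) :
    AddSubgroup ((Fin (k + 1) → G) → M) where
  carrier := {f | ∀ (g : G) (σ : Fin (k + 1) → G), f (fun i => g * σ i) <• g = f σ}
  zero_mem' := fun g _ => smul_zero (A := M) (MulOpposite.op g)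
  add_mem' := fun {a b} ha hb g σ => by
    rw [Pi.add_apply, smul_add, ha, hb, Pi.add_apply]
  neg_mem' := fun {a} ha g σ => by
    rw [Pi.neg_apply, smul_neg, ha, Pi.neg_apply]

/-- The coboundary map `(δf)(σ₀, …, σ_{k+1}) = ∑ᵢ (-1)ⁱ f(σ₀, …, σ̂ᵢ, …, σ_{k+1})`. -/
def coboundary (G M : Type) [AddCommGroup M] (k : ℕ) :
    ((Fin (k + 1) → G) → M) →+ ((Fin (k + 2) → G) → M) where
  toFun f σ := ∑ i : Fin (k + 2), (-1 : ℤ) ^ (i : ℕ) • f fun j => σ (i.succAbove j)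
  map_zero' := by
    funext σ
    simp
  map_add' f g := by
    funext σ
    simp [Finset.sum_add_distrib]

/-- The group `Z^k(G, M)` of homogeneous `k`-cocycles. -/
def HomCocycle (G M : Type) [Group G] [AddCommGroup M] [DistribMulAction Gᵐᵒᵖ M] (k : ℕ) :
    AddSubgroup ((Fin (k + 1) → G) → M) :=
  HomCochain G M k ⊓ (coboundary G M k).ker

/-- The group `B^k(G, M)` of homogeneous `k`-coboundaries. -/
def HomCoboundary (G M : Type) [Group G] [AddCommGroup M] [DistribMulAction Gᵐᵒᵖ M] :
    (k : ℕ) → AddSubgroup ((Fin (k + 1) → G) → M)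
  | 0 => ⊥
  | k + 1 => (HomCochain G M k).map (coboundary G M k)

/-- The group cohomology `H^k(G, M) = Z^k(G, M) / B^k(G, M)`. -/
abbrev GroupCohomology (G M : Type) [Group G] [AddCommGroup M] [DistribMulAction Gᵐᵒᵖ M]
    (k : ℕ) : Type :=
  HomCocycle G M k ⧸ (HomCoboundary G M k).addSubgroupOf (HomCocycle G M k)

open Classical in
/-- The function `Φ_λ(ξ)(γ₀, …, γ_k) = ξ([γ₀ · λ, …, γ_k · λ])` on `GL_n(ℚ)^{k+1}`. The simplex on
the right is only defined for covectors in general position; in all other cases the value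
of `Φ_λ(ξ)` is `0`. -/
def pullToGroup {n k : ℕ} {M : Type} [AddCommGroup M] (l : Covec n) (ξ : Chain n k →+ M) :
    (Fin (k + 1) → GLQ n) → M :=
  fun g => if h : GeneralPosition (fun i => covecAct (g i) l) then
    ξ (FreeAbelianGroup.of (simplex _ h)) else 0

/-! ### The rules defining the Kubota–Leopoldt distribution and the Stevens cocycle -/

/-- `η` is the multiplicative Kubota–Leopoldt distribution: its value at the characteristic
function of `a + dℤ` is the function `1 - exp(2πi (z - a)/d)`. As these characteristic functions
generate `𝒮(ℚ)`, there is at most one such `η`. -/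
def IsKubotaLeopoldt (η : Distr 1 (Additive (CGroup 1))) : Prop :=
  ∀ (a d : ℚ) (hd : 0 < d),
    ((((η (latticeIndicator a d hd)).toMul : CGroup 1) : (TrigRing 1)ˣ) : TrigRing 1).1 =
      fun z => 1 - Complex.exp (2 * Real.pi * Complex.I * ((z.1 0 - (a : ℂ)) / (d : ℂ)))

/-- The unit `η(f)(z_i)` of `ℛ(V)`. -/
def etaCoord {n : ℕ} (η : Distr 1 (Additive (CGroup 1))) (f : TestFun 1) (i : Fin n) :
    (TrigRing n)ˣ :=
  Units.map (coordPull i : TrigRing 1 →* TrigRing n)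
    (((η f).toMul : CGroup 1) : (TrigRing 1)ˣ)

/-- The rule for `ξ`: whenever `γ · λ_i = e_{i+1}^*` for `0 ≤ i ≤ n - 1`, and `f` is a test function
such that `γ · f = f₁ ⊗ ⋯ ⊗ f_n`, then
`ξ([λ₀, …, λ_{n-1}])(f) = {η(f₁)(z₁), …, η(f_n)(z_n)}|γ`. Here `n = m + 1`. -/
def IsStevens {m : ℕ} (η : Distr 1 (Additive (CGroup 1)))
    (ξ : Chain (m + 1) m →+ Distr (m + 1) (KTilde (m + 1) (m + 1))) : Prop :=
  ∀ (l : Fin (m + 1) → Covec (m + 1)) (hl : GeneralPosition l) (g : GLQ (m + 1)),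
    (∀ i, covecAct g (l i) = LinearMap.proj i) →
    ∀ (f : TestFun (m + 1)) (fs : Fin (m + 1) → TestFun 1), TestFun.act g f = tensor fs →
      ξ (FreeAbelianGroup.of (simplex l hl)) f =
        KTilde.symbol (fun i => etaCoord η (fs i) i) <• g

end

end StevensCocycle

open StevensCocycle

namespace StevensCocycle

noncomputable section

/-! ### The units `ε_w` and `1 - ε_w` -/

/-! Modulo `J̃` the classes of `-1` and of every `ε_w` vanish. Hence `{a, a} = {a, -a} = 0`, and
products of degree one classes are alternating. Write x(w) for the class of `1 - ε_w`. The identity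
`1 - ε_w = -ε_w (1 - ε_{-w})` gives x(-w) = x(w). Dividing `(1 - ε_w) + ε_w (1 - ε_{w'}) = 1 -
ε_{w+w'}` by its right side turns it into a Steinberg relation: (x(w) - x(w+w')) (x(w') - x(w+w')) =
0 as long as the linear parts of w, w' and w+w' are nonzero (`oneSubClass_mul`).

The distributions exist because `1 - y^e` factors over the `e`-th roots of unity (`oneSub_eq_prod`).
So a ↦ 1 - exp(2πi(z-a)/d) is compatible with splitting a + dℤ into cosets of deℤ, and any such
compatible rule on cosets of dℤⁿ extends to all test functions (`CosetRule.exists_hom`). This yields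
η and, by multilinearity of symbols, the distribution of the standard basis. A basis λ is carried to
the standard one by exactly one γ, so the distribution of λ is forced to be the translate by γ;
invariance is then formal. At the characteristic function of the coset of all x with b_i λ_i(x - a)
∈ ℤ, this translate is the product of the x(b_i λ_i(a), b_i λ_i) (`translate_coset`). The formula
contains only the products b_i λ_i, which shows independence of rescaling, and such cosets generate
all test functions, which shows uniqueness.

For the cocycle relation take n+1 nonzero covectors, some n of which form a basis. Up to a factor
there is one linear relation among them, and omitting the i-th leaves a basis exactly when its i-th
coefficient is nonzero. After rescaling, the relation says that the covectors with index in a set I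
sum to zero. Integrality on the members of one nondegenerate face then implies integrality on the
remaining covector, so one coset serves all nondegenerate faces. What remains is an identity between
products of the x(w_j), where the w_i with i ∈ I sum to zero (`sum_wedge_eq_zero`). Exterior algebra
reduces it to the vanishing of one product with factors x(w_j) - x(∑ w), and this follows from the
Steinberg relation by induction on the number of summands (`alternatingMap_eq_zero_of_sum`). As
general position is not assumed in this argument, the degenerate tuples in the group cocycle are
covered as well. -/

theorem evalC_add {n : ℕ} (l l' : Covec n) (z : Fin n → ℂ) :
    evalC (l + l') z = evalC l z + evalC l' z := by
  simp only [evalC, LinearMap.add_apply, Rat.cast_add, add_mul, Finset.sum_add_distrib]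

theorem evalC_smul {n : ℕ} (c : ℚ) (l : Covec n) (z : Fin n → ℂ) :
    evalC (c • l) z = c * evalC l z := by
  simp only [evalC, LinearMap.smul_apply, smul_eq_mul, Rat.cast_mul, Finset.mul_sum, mul_assoc]

theorem evalC_proj {n : ℕ} (i : Fin n) (z : Fin n → ℂ) :
    evalC (LinearMap.proj i : Covec n) z = z i := by
  simp [evalC, Pi.single_apply, apply_ite (Rat.cast : ℚ → ℂ)]

theorem eps_add {n : ℕ} (r r' : ℚ) (l l' : Covec n) :
    eps (r + r') (l + l') = eps r l * eps r' l' := by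
  funext z
  simp only [eps, Pi.mul_apply, ← Complex.exp_add, evalC_add]
  push_cast
  ring_nf

theorem eps_zero_zero {n : ℕ} : eps (0 : ℚ) (0 : Covec n) = 1 := by
  funext z
  simp [eps, evalC]

theorem eps_mul_eps_neg {n : ℕ} (r : ℚ) (l : Covec n) : eps r l * eps (-r) (-l) = 1 := by
  rw [← eps_add, add_neg_cancel, add_neg_cancel, eps_zero_zero]

theorem eps_add_int {n : ℕ} (r : ℚ) (k : ℤ) (l : Covec n) : eps (r + k) l = eps r l := by
  funext z
  simp only [eps]
  rw [Complex.exp_eq_exp_iff_exists_int]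
  exact ⟨-k, by push_cast; ring⟩

/-- The value 1 would force λ(z) = r + k with k an integer, a rational hyperplane that `Dom n`
excludes. -/
theorem eps_ne_one {n : ℕ} (r : ℚ) {l : Covec n} (hl : l ≠ 0) (z : Dom n) : eps r l z ≠ 1 := by
  intro h
  obtain ⟨k, hk⟩ := Complex.exp_eq_one_iff.mp h
  refine z.2 l hl (r + k) ?_
  have h2 : (2 * Real.pi * Complex.I : ℂ) ≠ 0 := Complex.two_pi_I_ne_zero
  have h3 : (2 * Real.pi * Complex.I : ℂ) * (evalC l z - r - k) = 0 := by
    linear_combination hk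
  have h4 := (mul_eq_zero.mp h3).resolve_left h2
  push_cast
  linear_combination h4

theorem eps_mem {n : ℕ} (r : ℚ) {l : Covec n} (hl : l ≠ 0) : eps r l ∈ TrigRing n :=
  Subring.subset_closure ⟨r, l, hl, Or.inl rfl⟩

open Classical in
/-- The unit `ε_w` of `ℛ(V)` for `w = (r, λ)`, `λ ≠ 0`, with value `1` for `λ = 0`. -/
def epsUnit {n : ℕ} (r : ℚ) (l : Covec n) : (TrigRing n)ˣ :=
  if hl : l ≠ 0 then
    { val := ⟨eps r l, eps_mem r hl⟩
      inv := ⟨eps (-r) (-l), eps_mem _ (neg_ne_zero.mpr hl)⟩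
      val_inv := Subtype.ext (eps_mul_eps_neg r l)
      inv_val := Subtype.ext ((mul_comm _ _).trans (eps_mul_eps_neg r l)) }
  else 1

theorem oneSub_mul_inv {n : ℕ} (r : ℚ) {l : Covec n} (hl : l ≠ 0) :
    (1 - eps r l) * (1 - eps r l)⁻¹ = 1 := by
  funext z
  exact mul_inv_cancel₀ (sub_ne_zero.mpr (eps_ne_one r hl z).symm)

open Classical in
/-- The unit `1 - ε_w` of `ℛ(V)` for `w = (r, λ)`, `λ ≠ 0`, with value `1` for `λ = 0`. -/
def oneSub {n : ℕ} (r : ℚ) (l : Covec n) : (TrigRing n)ˣ :=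
  if hl : l ≠ 0 then
    { val := ⟨1 - eps r l, sub_mem (one_mem _) (eps_mem r hl)⟩
      inv := ⟨(1 - eps r l)⁻¹, Subring.subset_closure ⟨r, l, hl, Or.inr rfl⟩⟩
      val_inv := Subtype.ext (oneSub_mul_inv r hl)
      inv_val := Subtype.ext ((mul_comm _ _).trans (oneSub_mul_inv r hl)) }
  else 1

theorem epsUnit_val {n : ℕ} (r : ℚ) {l : Covec n} (hl : l ≠ 0) :
    ((epsUnit r l : TrigRing n) : Dom n → ℂ) = eps r l := by
  rw [epsUnit, dif_pos hl]

theorem oneSub_val {n : ℕ} (r : ℚ) {l : Covec n} (hl : l ≠ 0) :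
    ((oneSub r l : TrigRing n) : Dom n → ℂ) = 1 - eps r l := by
  rw [oneSub, dif_pos hl]

theorem oneSub_zero {n : ℕ} (r : ℚ) : oneSub r (0 : Covec n) = 1 := by
  rw [oneSub, dif_neg (not_not.mpr rfl)]

theorem units_ext {n : ℕ} {u v : (TrigRing n)ˣ}
    (h : ((u : TrigRing n) : Dom n → ℂ) = ((v : TrigRing n) : Dom n → ℂ)) : u = v :=
  Units.ext (Subtype.ext h)

theorem epsUnit_mem {n : ℕ} (r : ℚ) (l : Covec n) : epsUnit r l ∈ EGroup n := by
  by_cases hl : l = 0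
  · rw [epsUnit, dif_neg (not_not.mpr hl)]
    exact one_mem _
  · exact Subgroup.subset_closure ⟨r, l, hl, epsUnit_val r hl⟩

theorem oneSub_mem {n : ℕ} (r : ℚ) (l : Covec n) : oneSub r l ∈ CGroup n := by
  by_cases hl : l = 0
  · rw [hl, oneSub_zero]
    exact one_mem _
  · exact Subgroup.subset_closure ⟨r, l, hl, Or.inr (oneSub_val r hl)⟩

theorem EGroup_le_CGroup (n : ℕ) : EGroup n ≤ CGroup n := by
  refine (Subgroup.closure_le _).mpr ?_
  rintro u ⟨r, l, hl, h⟩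
  exact Subgroup.subset_closure ⟨r, l, hl, Or.inl h⟩

theorem oneSub_add_int {n : ℕ} (r : ℚ) (k : ℤ) (l : Covec n) : oneSub (r + k) l = oneSub r l := by
  by_cases hl : l = 0
  · rw [hl, oneSub_zero, oneSub_zero]
  · exact units_ext (by rw [oneSub_val _ hl, oneSub_val _ hl, eps_add_int])

theorem map_trigPull_oneSub {n m : ℕ} (A : Matrix (Fin n) (Fin m) ℚ)
    (hA : ∀ l : Covec m, l ≠ 0 → covecPull A l ≠ 0) (r : ℚ) (l : Covec m) :
    Units.map (trigPull A hA : TrigRing m →* TrigRing n) (oneSub r l) =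
      oneSub r (covecPull A l) := by
  by_cases hl : l = 0
  · have h0 : covecPull A (0 : Covec m) = 0 := LinearMap.zero_comp _
    rw [hl, h0, oneSub_zero, oneSub_zero, map_one]
  · refine units_ext ?_
    rw [oneSub_val _ (hA l hl), ← pullFun_eps A hA, ← map_one (pullFun A hA), ← map_sub,
      ← oneSub_val r hl]
    rfl

/-- The roots of unity are enumerated as powers of the inverse root exp(-2πi/e), because adding j to
r multiplies ε_w by a negative power of exp(2πi/e) after division by e. -/
theorem one_sub_pow_eq_prod (y : ℂ) {e : ℕ} (he : 0 < e) :
    1 - y ^ e = ∏ j ∈ Finset.range e,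
      (1 - Complex.exp (2 * Real.pi * Complex.I * (-(j : ℂ) / e)) * y) := by
  have hζ := (Complex.isPrimitiveRoot_exp e he.ne').inv
  have h := hζ.pow_sub_pow_eq_prod_sub_mul 1 y he
  rw [one_pow] at h
  rw [h]
  symm
  have hpow : ∀ j : ℕ, Complex.exp (2 * Real.pi * Complex.I * (-(j : ℂ) / e)) =
      (Complex.exp (2 * Real.pi * Complex.I / e))⁻¹ ^ j := by
    intro j
    rw [← Complex.exp_neg, ← Complex.exp_nat_mul]
    ring_nf
  simp only [hpow]
  refine Finset.prod_nbij (fun j => (Complex.exp (2 * Real.pi * Complex.I / e))⁻¹ ^ j)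
    ?_ ?_ ?_ (fun _ _ => rfl)
  · intro j _
    rw [Polynomial.mem_nthRootsFinset he, pow_right_comm, hζ.pow_eq_one, one_pow]
  · intro i hi j hj hij
    exact hζ.pow_inj (by simpa using hi) (by simpa using hj) hij
  · intro w hw
    have : NeZero e := ⟨he.ne'⟩
    obtain ⟨i, hi, rfl⟩ := hζ.eq_pow_of_pow_eq_one ((Polynomial.mem_nthRootsFinset he 1).mp hw)
    exact ⟨i, by simpa using hi, rfl⟩

theorem one_sub_eps_eq_prod {n : ℕ} (r : ℚ) (l : Covec n) {e : ℕ} (he : 0 < e) :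
    1 - eps r l = ∏ j ∈ Finset.range e, (1 - eps ((r + j) / e) ((e : ℚ)⁻¹ • l)) := by
  have he' : (e : ℂ) ≠ 0 := Nat.cast_ne_zero.mpr he.ne'
  funext z
  simp only [Finset.prod_apply, Pi.sub_apply, Pi.one_apply]
  have h1 : eps r l z =
      Complex.exp (2 * Real.pi * Complex.I * ((evalC l z - (r : ℂ)) / e)) ^ e := by
    rw [← Complex.exp_nat_mul, eps]
    congr 1
    field_simp
  rw [h1, one_sub_pow_eq_prod _ he]
  refine Finset.prod_congr rfl fun j _ => ?_
  rw [← Complex.exp_add, eps, evalC_smul]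
  congr 2
  push_cast
  field_simp
  ring

/-- The distribution relation. -/
theorem oneSub_eq_prod {n : ℕ} (r : ℚ) (l : Covec n) {e : ℕ} (he : 0 < e) :
    oneSub r l = ∏ j ∈ Finset.range e, oneSub ((r + j) / e) ((e : ℚ)⁻¹ • l) := by
  by_cases hl : l = 0
  · simp [hl, oneSub_zero]
  · have he' : ((e : ℚ)⁻¹ • l) ≠ 0 := smul_ne_zero (by positivity) hl
    refine units_ext ?_
    rw [oneSub_val r hl, one_sub_eps_eq_prod r l he, Units.coe_prod, SubmonoidClass.coe_finsetProd]
    exact Finset.prod_congr rfl fun j _ => (oneSub_val _ he').symm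

/-! ### Milnor `K`-theory modulo `J̃` -/

/-- The ring `K^M(ℛ(V)) / J̃(V)`. -/
abbrev KQuot (n : ℕ) : Type := (JTilde n).ringCon.Quotient

/-- The class of `{a}` in `K^M(ℛ(V)) / J̃(V)`. -/
def bracket (n : ℕ) : Additive (TrigRing n)ˣ →+ KQuot n :=
  (JTilde n).ringCon.mk'.toAddMonoidHom.comp (MilnorK.bracketHom (TrigRing n))

theorem mk_eq_zero_iff {n : ℕ} (x : MilnorK (TrigRing n)) :
    (JTilde n).ringCon.mk' x = 0 ↔ x ∈ JTilde n := by
  rw [← TwoSidedIdeal.mem_ker, TwoSidedIdeal.ker_ringCon_mk']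

theorem bracket_neg_one {n : ℕ} : bracket n (Additive.ofMul (-1)) = 0 :=
  (mk_eq_zero_iff _).mpr (TwoSidedIdeal.subset_span (Or.inr rfl))

/-- A symbol of length one with entry in ℰ already lies in `J_1`. -/
theorem bracket_EGroup {n : ℕ} {u : (TrigRing n)ˣ} (hu : u ∈ EGroup n) :
    bracket n (Additive.ofMul u) = 0 := by
  refine (mk_eq_zero_iff _).mpr (TwoSidedIdeal.subset_span (Or.inl ⟨1, ?_⟩))
  refine AddSubgroup.subset_closure ⟨fun _ => u, fun _ => EGroup_le_CGroup n hu, ⟨0, hu⟩, ?_⟩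
  simp [MilnorK.symbol]

theorem bracket_mul_eq_zero {n : ℕ} (a b : (TrigRing n)ˣ)
    (h : (a : TrigRing n) + b = 0 ∨ (a : TrigRing n) + b = 1) :
    bracket n (Additive.ofMul a) * bracket n (Additive.ofMul b) = 0 := by
  have := congrArg (JTilde n).ringCon.mk' (MilnorK.bracket_mul a b h)
  rwa [map_mul, map_zero] at this

/-- The relation `{a, -a} = 0` is part of the definition of K^M, and -a has the same class as a
because that of -1 is zero. -/
theorem bracket_mul_self {n : ℕ} (a : Additive (TrigRing n)ˣ) :
    bracket n a * bracket n a = 0 := by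
  have h := bracket_mul_eq_zero a.toMul (-a.toMul) (Or.inl (by simp))
  have h2 : Additive.ofMul (-a.toMul) = a + Additive.ofMul (-1) := by
    rw [← ofMul_toMul a, ← ofMul_mul]
    simp
  rwa [h2, map_add, bracket_neg_one, add_zero, ofMul_toMul] at h

/-- The inclusion of `K̃_k^M(V)` into `K^M(ℛ(V)) / J̃(V)`. -/
def KTilde.toKQuot (n k : ℕ) : KTilde n k →+ KQuot n :=
  QuotientAddGroup.lift (JTildeDeg n k)
    ((JTilde n).ringCon.mk'.toAddMonoidHom.comp (MilnorK.degree (TrigRing n) k).subtype)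
    fun _ hx => (mk_eq_zero_iff _).mpr hx

/-- `J̃_k` is by definition the intersection of the ideal with degree k. Identities in `K̃_k` may
therefore be checked in the quotient ring, where symbols are ordered products. -/
theorem KTilde.toKQuot_injective (n k : ℕ) : Function.Injective (KTilde.toKQuot n k) := by
  refine (injective_iff_map_eq_zero _).mpr fun x hx => ?_
  obtain ⟨y, rfl⟩ := QuotientAddGroup.mk'_surjective (JTildeDeg n k) x
  exact (QuotientAddGroup.eq_zero_iff y).mpr ((mk_eq_zero_iff _).mp hx)

theorem KTilde.toKQuot_symbol {n k : ℕ} (x : Fin k → (TrigRing n)ˣ) :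
    KTilde.toKQuot n k (KTilde.symbol x) =
      (List.ofFn fun i => bracket n (Additive.ofMul (x i))).prod := by
  have h : KTilde.toKQuot n k (KTilde.symbol x) = (JTilde n).ringCon.mk' (MilnorK.symbol x) := rfl
  rw [h, MilnorK.symbol, map_list_prod, List.map_ofFn]
  rfl

/-- The symbol `{x₁, …, x_k}` as a multilinear map. -/
def KTilde.multi (n k : ℕ) :
    MultilinearMap ℤ (fun _ : Fin k => Additive (TrigRing n)ˣ) (KTilde n k) :=
  have key : ∀ x : Fin k → Additive (TrigRing n)ˣ,
      KTilde.toKQuot n k (KTilde.symbol fun i => (x i).toMul) =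
        (MultilinearMap.mkPiAlgebraFin ℤ k (KQuot n)).compLinearMap
          (fun _ => (bracket n).toIntLinearMap) x := fun x => KTilde.toKQuot_symbol _
  { toFun := fun x => KTilde.symbol fun i => (x i).toMul
    map_update_add' := fun x i a b => KTilde.toKQuot_injective n k <| by
      rw [map_add, key, key, key]
      convert MultilinearMap.map_update_add _ x i a b
    map_update_smul' := fun x i c a => KTilde.toKQuot_injective n k <| by
      rw [map_zsmul, key, key]
      convert MultilinearMap.map_update_smul _ x i c a }

/-- The degree one part of `K^M(ℛ(V)) / J̃(V)`. -/
abbrev KOne (n : ℕ) : Type := (bracket n).toIntLinearMap.range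

/-- The product of `k` elements of degree one in `K^M(ℛ(V)) / J̃(V)`. -/
def wedge (n k : ℕ) : KOne n [⋀^Fin k]→ₗ[ℤ] KQuot n :=
  -- Degree one elements square to zero, so their products factor through the exterior algebra.
  (ExteriorAlgebra.lift ℤ ⟨(bracket n).toIntLinearMap.range.subtype, by
    rintro ⟨_, a, rfl⟩
    exact bracket_mul_self a⟩).toLinearMap.compAlternatingMap (ExteriorAlgebra.ιMulti ℤ k)

theorem wedge_apply {n k : ℕ} (v : Fin k → KOne n) :
    wedge n k v = (List.ofFn fun i => (v i : KQuot n)).prod := by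
  rw [wedge, LinearMap.compAlternatingMap_apply, ExteriorAlgebra.ιMulti_apply,
    AlgHom.toLinearMap_apply, map_list_prod, List.map_ofFn]
  congr 2
  funext i
  exact ExteriorAlgebra.lift_ι_apply ..

/-- The class of `1 - ε_w` in the degree one part of `K^M(ℛ(V)) / J̃(V)`. -/
def oneSubClass {n : ℕ} (w : ℚ × Covec n) : KOne n :=
  ⟨bracket n (Additive.ofMul (oneSub w.1 w.2)), LinearMap.mem_range_self _ _⟩

theorem KTilde.toKQuot_oneSub {n k : ℕ} (w : Fin k → ℚ × Covec n) :
    KTilde.toKQuot n k (KTilde.symbol fun i => oneSub (w i).1 (w i).2) =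
      wedge n k fun i => oneSubClass (w i) := by
  rw [KTilde.toKQuot_symbol, wedge_apply]
  rfl

/-! ### Parity and the Steinberg relation for the classes of 1 - ε_w -/

/-- Since `1 - ε_w = -ε_w (1 - ε_{-w})`, the two units differ by a factor whose class is zero. -/
theorem oneSubClass_neg {n : ℕ} (w : ℚ × Covec n) : oneSubClass (-w) = oneSubClass w := by
  refine Subtype.ext ?_
  obtain ⟨r, l⟩ := w
  change bracket n (Additive.ofMul (oneSub (-r) (-l))) = bracket n (Additive.ofMul (oneSub r l))
  by_cases hl : l = 0
  · rw [hl, neg_zero, oneSub_zero, oneSub_zero]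
  · have h : oneSub r l = -1 * epsUnit r l * oneSub (-r) (-l) := by
      refine units_ext ?_
      have hl' := neg_ne_zero.mpr hl
      have h3 := eps_mul_eps_neg r l
      push_cast
      rw [oneSub_val r hl, oneSub_val _ hl', epsUnit_val r hl]
      linear_combination -h3
    rw [h, ofMul_mul, ofMul_mul, map_add, map_add, bracket_neg_one,
      bracket_EGroup (epsUnit_mem r l), zero_add, zero_add]

theorem wedge_eq_zero {n k : ℕ} (v : Fin k → KOne n) {p q : Fin k} (hpq : p ≠ q)
    (h : (v p : KQuot n) * v q = 0) : wedge n k v = 0 := by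
  obtain ⟨N, rfl⟩ : ∃ N, k = N + 2 := by
    refine ⟨k - 2, ?_⟩
    have := p.2
    have := q.2
    have : (p : ℕ) ≠ q := fun h => hpq (Fin.ext h)
    omega
  obtain ⟨σ, h0, h1⟩ : ∃ σ : Equiv.Perm (Fin (N + 2)), σ 0 = p ∧ σ 1 = q := by
    -- The first swap sends 0 to p; the second moves the image of 1 to q and leaves p alone.
    refine ⟨Equiv.swap (Equiv.swap 0 p 1) q * Equiv.swap 0 p, ?_, ?_⟩
    · rw [Equiv.Perm.mul_apply, Equiv.swap_apply_left, Equiv.swap_apply_of_ne_of_ne _ hpq]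
      intro h
      have := congrArg (Equiv.swap 0 p) h
      rw [Equiv.swap_apply_right, Equiv.swap_apply_self] at this
      exact zero_ne_one this
    · rw [Equiv.Perm.mul_apply, Equiv.swap_apply_left]
  have h2 := (wedge n (N + 2)).map_perm v σ
  rw [wedge_apply, List.ofFn_succ, List.ofFn_succ, List.prod_cons, List.prod_cons] at h2
  simp only [Function.comp_apply, Fin.succ_zero_eq_one, h0, h1] at h2
  rw [← mul_assoc, h, zero_mul] at h2
  rcases Int.units_eq_one_or (Equiv.Perm.sign σ) with h3 | h3 <;> rw [h3] at h2
  · simpa using h2.symm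
  · simpa using h2.symm

/-- The units `(1 - ε_w)/(1 - ε_{w+w'})` and `ε_w (1 - ε_{w'})/(1 - ε_{w+w'})` add up to 1, and the
factor `ε_w` has class zero. The three conditions on linear parts are needed for these quotients to
be the actual functions, since `oneSub` has the default value 1 at λ = 0. -/
theorem oneSubClass_mul {n : ℕ} (w w' : ℚ × Covec n) (h : w.2 ≠ 0) (h' : w'.2 ≠ 0)
    (hs : w.2 + w'.2 ≠ 0) :
    (((oneSubClass w - oneSubClass (w + w') : KOne n) : KQuot n)) *
      ((oneSubClass w' - oneSubClass (w + w') : KOne n) : KQuot n) = 0 := by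
  obtain ⟨r, l⟩ := w
  obtain ⟨r', l'⟩ := w'
  have hrel := bracket_mul_eq_zero (oneSub r l * (oneSub (r + r') (l + l'))⁻¹)
    (epsUnit r l * oneSub r' l' * (oneSub (r + r') (l + l'))⁻¹) (Or.inr (by
      have h1 : (oneSub r l : TrigRing n) + (epsUnit r l * oneSub r' l' : (TrigRing n)ˣ) =
          oneSub (r + r') (l + l') := by
        refine Subtype.ext ?_
        push_cast
        rw [oneSub_val _ h, oneSub_val _ h', oneSub_val _ hs, epsUnit_val _ h, eps_add]
        ring
      rw [Units.val_mul, Units.val_mul, ← add_mul, h1, Units.mul_inv]))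
  simp only [ofMul_mul, ofMul_inv, map_add, map_neg, bracket_EGroup (epsUnit_mem r l),
    zero_add] at hrel
  simp only [← sub_eq_add_neg] at hrel
  exact hrel

end

end StevensCocycle

namespace StevensCocycle

/-! ### Alternating maps -/

/-- The entries are altered one at a time, by induction on the set of altered slots. Each change
adds a multiple of the entry in slot i₀, which stays fixed because c i₀ = 0. -/
theorem alternatingMap_add_smul {R M N ι : Type*} [CommRing R] [AddCommGroup M] [Module R M]
    [AddCommGroup N] [Module R N] [Fintype ι] [DecidableEq ι] (T : M [⋀^ι]→ₗ[R] N) (v : ι → M)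
    (c : ι → R) (i₀ : ι) (hc : c i₀ = 0) : T (fun j => v j + c j • v i₀) = T v := by
  have key : ∀ s : Finset ι, T (fun j => if j ∈ s then v j + c j • v i₀ else v j) = T v := by
    intro s
    induction s using Finset.induction_on with
    | empty => simp
    | insert a s ha ih =>
      set F : ι → M := fun j => if j ∈ s then v j + c j • v i₀ else v j with hF
      have hFa : F a = v a := by simp [hF, ha]
      have hF0 : F i₀ = v i₀ := by simp [hF, hc]
      have h1 : (fun j => if j ∈ insert a s then v j + c j • v i₀ else v j) =
          Function.update F a (F a + c a • F i₀) := by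
        funext j
        by_cases hj : j = a
        · subst hj
          simp [hFa, hF0]
        · simp [hF, hj]
      rw [h1, T.map_update_add, T.map_update_smul, Function.update_eq_self, ih]
      by_cases hai : a = i₀
      · rw [hai, hc, zero_smul, add_zero]
      · rw [T.map_update_self _ hai, smul_zero, add_zero]
  simpa using key Finset.univ

/-- The sum is the value of the alternating form T = C ∧ S at the standard basis e of ℤ^(k+1), where
C(e_i) = c_i and S is pulled back along e_i ↦ y_i. Replacing e_j by e_j - c_j e_{i₀} for j ≠ i₀ does
not change T. It moves these vectors into the kernel of C, so only the term at i₀ survives, and the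
hypothesis says that this term is zero. -/
theorem sum_alternatingMap_succAbove {W N : Type*} [AddCommGroup W] [AddCommGroup N] {k : ℕ}
    (S : W [⋀^Fin k]→ₗ[ℤ] N) (y : Fin (k + 1) → W) (c : Fin (k + 1) → ℤ) (i₀ : Fin (k + 1))
    (hc : c i₀ = 1)
    (h : S (fun j => y (i₀.succAbove j) - c (i₀.succAbove j) • y i₀) = 0) :
    ∑ i : Fin (k + 1), (-1 : ℤ) ^ (i : ℕ) • c i • S (fun j => y (i.succAbove j)) = 0 := by
  set L := Fintype.linearCombination ℤ y with hL
  set C := Fintype.linearCombination ℤ c with hC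
  set T := AlternatingMap.alternatizeUncurryFin (C.smulRight (S.compLinearMap L)) with hT
  have hT' : ∀ v, T v = ∑ i : Fin (k + 1), (-1 : ℤ) ^ (i : ℕ) • C (v i) •
      S (fun j => L (v (i.succAbove j))) := by
    intro v
    rw [hT, AlternatingMap.alternatizeUncurryFin_apply]
    rfl
  have hLe : ∀ i, L (Pi.single i 1) = y i := by
    intro i
    rw [hL, Fintype.linearCombination_apply_single, one_smul]
  have hCe : ∀ i, C (Pi.single i 1) = c i := by
    intro i
    rw [hC, Fintype.linearCombination_apply_single, one_smul]
  have h1 := alternatingMap_add_smul T (fun i => Pi.single i 1)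
    (fun j => if j = i₀ then 0 else -c j) i₀ (if_pos rfl)
  rw [hT', hT'] at h1
  simp only [map_add, map_smul, hLe, hCe] at h1
  rw [← h1]
  refine (Finset.sum_eq_single i₀ (fun i _ hi => ?_) (by simp)).trans ?_
  · simp [hi, hc]
  · simp only [Fin.succAbove_ne, if_false, neg_smul, ← sub_eq_add_neg, h, smul_zero]

/-- Merging the summand p into the summand q preserves sums; the induction below uses this to
shorten a family by one. -/
theorem sum_update_add {ι P : Type*} [DecidableEq ι] [AddCommGroup P] (w : ι → P) {p q : ι}
    (s : Finset ι) (hp : p ∉ s) (hq : q ∈ s) :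
    ∑ j ∈ s, Function.update w q (w p + w q) j = ∑ j ∈ insert p s, w j := by
  rw [Finset.sum_update_of_mem hq, Finset.sum_insert hp, add_assoc, ← Finset.erase_eq,
    Finset.add_sum_erase _ _ hq]

/-- Induction on the size of J: one summand gives a zero entry, and otherwise two summands p and q
are merged. The hypothesis `hS` abstracts the Steinberg relation, and `good` stands for a nonzero
linear part. All partial sums must be good because every merged summand is used again in the
induction. -/
theorem alternatingMap_eq_zero_of_sum {P W N : Type*} [AddCommGroup P] [AddCommGroup W]
    [AddCommGroup N] {k : ℕ} (S : W [⋀^Fin k]→ₗ[ℤ] N) (x : P → W) (good : P → Prop)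
    (hS : ∀ (v : Fin k → W) (p q : Fin k) (w w' : P), p ≠ q → good w → good w' → good (w + w') →
      v p = x w - x (w + w') → v q = x w' - x (w + w') → S v = 0)
    (J : Finset (Fin k)) (hJ : J.Nonempty) (w : Fin k → P)
    (hw : ∀ s ⊆ J, s.Nonempty → good (∑ j ∈ s, w j)) (v : Fin k → W)
    (hv : ∀ j ∈ J, v j = x (w j) - x (∑ i ∈ J, w i)) : S v = 0 := by
  induction hn : J.card generalizing J w v with
  | zero => exact absurd (Finset.card_eq_zero.mp hn) hJ.ne_empty
  | succ n ih =>
    rcases Nat.eq_zero_or_pos n with rfl | hpos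
    · obtain ⟨j, rfl⟩ := Finset.card_eq_one.mp hn
      refine S.map_coord_zero j ?_
      rw [hv j (Finset.mem_singleton_self j), Finset.sum_singleton, sub_self]
    · obtain ⟨p, hp, q, hq, hpq⟩ := Finset.one_lt_card.mp (show 1 < J.card by omega)
      -- The induction hypothesis is applied to J without p, with w q replaced by w p + w q. The
      -- total is unchanged and the entry in slot p becomes arbitrary.
      have merge : ∀ p ∈ J, ∀ q ∈ J, p ≠ q → ∀ v : Fin k → W,
          (∀ j ∈ J, j ≠ p → j ≠ q → v j = x (w j) - x (∑ i ∈ J, w i)) →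
          v q = x (w p + w q) - x (∑ i ∈ J, w i) → S v = 0 := by
        intro p hp q hq hpq v hv hvq
        have hq' : q ∈ J.erase p := Finset.mem_erase.mpr ⟨hpq.symm, hq⟩
        have hsum : ∑ i ∈ J.erase p, Function.update w q (w p + w q) i = ∑ i ∈ J, w i := by
          rw [sum_update_add w _ (Finset.notMem_erase p J) hq', Finset.insert_erase hp]
        refine ih (J.erase p) ⟨q, hq'⟩ (Function.update w q (w p + w q)) ?_ v ?_ ?_
        · intro s hs hne
          have hps : p ∉ s := fun h => Finset.notMem_erase p J (hs h)
          by_cases hqs : q ∈ s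
          · rw [sum_update_add w s hps hqs]
            exact hw _ (Finset.insert_subset hp (hs.trans (Finset.erase_subset p J)))
              (Finset.insert_nonempty p s)
          · rw [Finset.sum_update_of_notMem hqs]
            exact hw _ (hs.trans (Finset.erase_subset p J)) hne
        · intro j hj
          rw [hsum]
          by_cases hjq : j = q
          · rw [hjq, Function.update_self, hvq]
          · rw [Function.update_of_ne hjq]
            exact hv j (Finset.mem_of_mem_erase hj) (Finset.ne_of_mem_erase hj) hjq
        · rw [Finset.card_erase_of_mem hp, hn]
          rfl
      -- With s, t, u, z the values of x at w p, w q, w p + w q and the total, the goal is F(s - z,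
      -- t - z) = 0. The Steinberg relation gives F(s - u, t - u) = 0, and merging gives F(s, u) =
      -- F(s, z) and F(u, t) = F(z, t). Expanding with F(a, a) = 0 finishes.
      set F : W → W → N := fun a b => S (Function.update (Function.update v p a) q b) with hF
      have hF1 : ∀ a a' b, F (a - a') b = F a b - F a' b := by
        intro a a' b
        simp only [hF, Function.update_comm hpq]
        exact S.map_update_sub _ _ _ _
      have hF2 : ∀ a b b', F a (b - b') = F a b - F a b' := fun a b b' =>
        S.map_update_sub _ _ _ _
      have hF3 : ∀ a, F a a = 0 := fun a =>
        S.map_eq_zero_of_eq _ (by simp [Function.update_of_ne hpq]) hpq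
      have hSv : S v = F (x (w p) - x (∑ i ∈ J, w i)) (x (w q) - x (∑ i ∈ J, w i)) := by
        rw [hF, ← hv p hp, ← hv q hq]
        simp
      have hgp : good (w p) := by
        simpa using hw {p} (Finset.singleton_subset_iff.mpr hp) (Finset.singleton_nonempty p)
      have hgq : good (w q) := by
        simpa using hw {q} (Finset.singleton_subset_iff.mpr hq) (Finset.singleton_nonempty q)
      have hgpq : good (w p + w q) := by
        have := hw {p, q} (Finset.insert_subset hp (Finset.singleton_subset_iff.mpr hq))
          (Finset.insert_nonempty p _)
        rwa [Finset.sum_pair hpq] at this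
      have e1 : F (x (w p) - x (w p + w q)) (x (w q) - x (w p + w q)) = 0 :=
        hS _ p q _ _ hpq hgp hgq hgpq (by simp [Function.update_of_ne hpq]) (by simp)
      have e2 : F (x (w p)) (x (w p + w q) - x (∑ i ∈ J, w i)) = 0 := by
        refine merge p hp q hq hpq _ (fun j hj hjp hjq => ?_) (by simp)
        rw [Function.update_of_ne hjq, Function.update_of_ne hjp, hv j hj]
      have e3 : F (x (w p + w q) - x (∑ i ∈ J, w i)) (x (w q)) = 0 := by
        refine merge q hq p hp hpq.symm _ (fun j hj hjq hjp => ?_) ?_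
        · rw [Function.update_of_ne hjq, Function.update_of_ne hjp, hv j hj]
        · rw [Function.update_of_ne hpq, Function.update_self, add_comm]
      rw [hSv]
      simp only [hF1, hF2, hF3] at e1 e2 e3 ⊢
      rw [sub_eq_zero] at e2 e3
      rw [e2, e3] at e1
      exact e1

end StevensCocycle

namespace StevensCocycle

noncomputable section

/-! ### Test functions as combinations of characteristic functions of cosets -/

/-- The points of `M⁻¹ ℤⁿ` in the box `[0, D)ⁿ`. -/
def grid (n D M : ℕ) : Finset (Vec n) :=
  Fintype.piFinset fun _ => (Finset.range (D * M)).image fun k : ℕ => (k : ℚ) / M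

theorem mem_grid {n D M : ℕ} (hM : 0 < M) {a : Vec n} :
    a ∈ grid n D M ↔ ∀ i, 0 ≤ a i ∧ a i < D ∧ ∃ k : ℤ, (M : ℚ) * a i = k := by
  have hM' : (0 : ℚ) < M := Nat.cast_pos.mpr hM
  simp only [grid, Fintype.mem_piFinset, Finset.mem_image, Finset.mem_range]
  refine forall_congr' fun i => ⟨?_, ?_⟩
  · rintro ⟨k, hk, h⟩
    rw [← h]
    refine ⟨by positivity, ?_, k, ?_⟩
    · rw [div_lt_iff₀ hM']
      exact_mod_cast hk
    · push_cast
      field_simp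
  · rintro ⟨h0, h1, k, hk⟩
    have hk0 : (0 : ℚ) ≤ k := hk ▸ mul_nonneg hM'.le h0
    lift k to ℕ using (by exact_mod_cast hk0)
    refine ⟨k, ?_, ?_⟩
    · have : (k : ℚ) < D * M := by
        push_cast at hk
        rw [← hk, mul_comm]
        exact mul_lt_mul_of_pos_right h1 hM'
      exact_mod_cast this
    · push_cast at hk
      rw [← hk]
      field_simp

/-- `f` is periodic with respect to `D ℤⁿ` and supported in `M⁻¹ ℤⁿ`. -/
structure Adapted {n : ℕ} (f : TestFun n) (D M : ℕ) : Prop where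
  period_pos : 0 < D
  denom_pos : 0 < M
  periodic : ∀ (x : Vec n) (v : Fin n → ℤ), f.1 (x + fun i => (D : ℚ) * (v i : ℚ)) = f.1 x
  support : ∀ x : Vec n, f.1 x ≠ 0 → ∀ i, ∃ k : ℤ, (M : ℚ) * x i = k

theorem exists_adapted {n : ℕ} (f : TestFun n) : ∃ D M, Adapted f D M := by
  obtain ⟨f, ⟨D, hD, h⟩, M, hM, h'⟩ := f
  refine ⟨D, M, hD, hM, h, fun x hx i => ?_⟩
  obtain ⟨v, hv⟩ := h' x hx
  exact ⟨v i, hv i⟩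

theorem Adapted.mul {n : ℕ} {f : TestFun n} {D M : ℕ} (h : Adapted f D M) {E N : ℕ} (hE : 0 < E)
    (hN : 0 < N) : Adapted f (D * E) (M * N) where
  period_pos := Nat.mul_pos h.period_pos hE
  denom_pos := Nat.mul_pos h.denom_pos hN
  periodic x v := by
    rw [← h.periodic x fun i => E * v i]
    refine congrArg (fun y => f.1 (x + y)) (funext fun i => ?_)
    push_cast
    ring
  support x hx i := by
    obtain ⟨k, hk⟩ := h.support x hx i
    refine ⟨N * k, ?_⟩
    push_cast
    rw [← hk]
    ring

theorem Adapted.of_dvd {n : ℕ} {f : TestFun n} {D M : ℕ} (h : Adapted f D M) {D' M' : ℕ}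
    (hD' : 0 < D') (hM' : 0 < M') (hD : D ∣ D') (hM : M ∣ M') : Adapted f D' M' := by
  obtain ⟨E, rfl⟩ := hD
  obtain ⟨N, rfl⟩ := hM
  exact h.mul (Nat.pos_of_mul_pos_left hD') (Nat.pos_of_mul_pos_left hM')

theorem exists_adapted_family {n : ℕ} {ι : Type*} [Fintype ι] (f : ι → TestFun n) :
    ∃ D M, ∀ i, Adapted (f i) D M := by
  choose D M h using fun i => exists_adapted (f i)
  exact ⟨∏ i, D i, ∏ i, M i, fun i => (h i).of_dvd
    (Finset.prod_pos fun j _ => (h j).period_pos) (Finset.prod_pos fun j _ => (h j).denom_pos)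
    (Finset.dvd_prod_of_mem _ (Finset.mem_univ i)) (Finset.dvd_prod_of_mem _ (Finset.mem_univ i))⟩

theorem Adapted.tensor {n : ℕ} {f : Fin n → TestFun 1} {D M : ℕ} (hD : 0 < D) (hM : 0 < M)
    (h : ∀ i, Adapted (f i) D M) : Adapted (tensor f) D M where
  period_pos := hD
  denom_pos := hM
  periodic x v := by
    change ∏ i, (f i).1 (fun _ => (x + fun i => (D : ℚ) * (v i : ℚ)) i) =
      ∏ i, (f i).1 (fun _ => x i)
    exact Finset.prod_congr rfl fun i _ => (h i).periodic (fun _ => x i) fun _ => v i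
  support x hx i := by
    have hx' : ∏ i, (f i).1 (fun _ => x i) ≠ 0 := hx
    exact (h i).support (fun _ => x i) (Finset.prod_ne_zero_iff.mp hx' i (Finset.mem_univ i)) 0

/-- The reduction of `x` modulo `D ℤⁿ` to the box `[0, D)ⁿ`. -/
def boxRep {n : ℕ} (D : ℕ) (x : Vec n) : Vec n := fun i => x i - D * ⌊x i / D⌋

theorem boxRep_add {n : ℕ} (D : ℕ) (x : Vec n) :
    (boxRep D x + fun i => (D : ℚ) * (⌊x i / D⌋ : ℚ)) = x := by
  funext i
  simp [boxRep]

theorem boxRep_bounds {n D : ℕ} (hD : 0 < D) (x : Vec n) (i : Fin n) :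
    0 ≤ boxRep D x i ∧ boxRep D x i < D := by
  have hD' : (0 : ℚ) < D := Nat.cast_pos.mpr hD
  have h1 := Int.floor_le (x i / D)
  have h2 := Int.lt_floor_add_one (x i / D)
  rw [le_div_iff₀ hD'] at h1
  rw [div_lt_iff₀ hD'] at h2
  constructor <;> simp only [boxRep] <;> linarith

/-- Uniqueness of representatives modulo D in [0, D). -/
theorem eq_of_box {D : ℕ} {s t : ℚ} (hs : 0 ≤ s ∧ s < D) (ht : 0 ≤ t ∧ t < D) (k : ℤ)
    (h : s = t + D * k) : k = 0 := by
  have hD : (0 : ℚ) < D := hs.1.trans_lt hs.2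
  have h1 : (D : ℚ) * k < D * 1 := by linarith
  have h2 : (D : ℚ) * (-1) < D * k := by linarith
  have h3 : (k : ℚ) < 1 := lt_of_mul_lt_mul_left h1 hD.le
  have h4 : (-1 : ℚ) < k := lt_of_mul_lt_mul_left h2 hD.le
  have h5 : k < 1 := by exact_mod_cast h3
  have h6 : -1 < k := by exact_mod_cast h4
  omega

/-- The characteristic function of `a + d ℤⁿ`. -/
def cosetInd {n : ℕ} (a : Vec n) (d : ℚ) (hd : 0 < d) : TestFun n :=
  tensor fun i => latticeIndicator (a i) d hd

open Classical in
theorem latticeIndicator_apply (a d : ℚ) (hd : 0 < d) (x : Vec 1) :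
    (latticeIndicator a d hd).1 x = if ∃ k : ℤ, x 0 = a + d * k then 1 else 0 := rfl

open Classical in
theorem tensor_latticeIndicator_apply {n : ℕ} (a d : Fin n → ℚ) (hd : ∀ i, 0 < d i) (x : Vec n) :
    (tensor fun i => latticeIndicator (a i) (d i) (hd i)).1 x =
      if ∀ i, ∃ k : ℤ, x i = a i + d i * k then 1 else 0 := by
  change ∏ i, (if ∃ k : ℤ, x i = a i + d i * k then (1 : ℤ) else 0) = _
  split_ifs with h
  · exact Finset.prod_eq_one fun i _ => if_pos (h i)
  · push Not at h
    obtain ⟨i, hi⟩ := h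
    exact Finset.prod_eq_zero (Finset.mem_univ i) (if_neg (not_exists.mpr hi))

/-- A point x can lie only in the coset of its box representative. If that representative is not a
grid point, the support condition makes f vanish at x. -/
theorem Adapted.eq_sum {n : ℕ} {f : TestFun n} {D M : ℕ} (h : Adapted f D M) :
    f = ∑ a ∈ grid n D M, f.1 a • cosetInd a D (Nat.cast_pos.mpr h.period_pos) := by
  classical
  refine Subtype.ext (funext fun x => ?_)
  have hfx : f.1 (boxRep D x) = f.1 x := by
    conv_rhs => rw [← boxRep_add D x]
    exact (h.periodic _ _).symm
  rw [AddSubgroup.val_finsetSum, Finset.sum_apply, Finset.sum_eq_single (boxRep D x)]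
  · change _ = f.1 _ • (cosetInd _ _ _).1 x
    rw [hfx, cosetInd, tensor_latticeIndicator_apply, if_pos, smul_eq_mul, mul_one]
    exact fun i => ⟨_, (congrFun (boxRep_add D x) i).symm⟩
  · intro a ha hne
    change f.1 _ • (cosetInd _ _ _).1 x = 0
    rw [cosetInd, tensor_latticeIndicator_apply, if_neg, smul_zero]
    intro hx
    apply hne
    funext i
    obtain ⟨k, hk⟩ := hx i
    have ha' := (mem_grid h.denom_pos).mp ha i
    have h1 : boxRep D x i = a i + D * (k - ⌊x i / D⌋ : ℤ) := by
      simp only [boxRep]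
      push_cast
      linear_combination hk
    rw [h1, eq_of_box (boxRep_bounds h.period_pos x i) ⟨ha'.1, ha'.2.1⟩ _ h1]
    simp
  · intro hx
    change f.1 _ • (cosetInd _ _ _).1 x = 0
    have h0 : f.1 (boxRep D x) = 0 := by
      by_contra h1
      refine hx ((mem_grid h.denom_pos).mpr fun i => ?_)
      have hb := boxRep_bounds h.period_pos x i
      exact ⟨hb.1, hb.2, h.support _ h1 i⟩
    rw [h0, zero_smul]

theorem Adapted.cosetInd {n : ℕ} (a : Vec n) {D : ℕ} (hD : 0 < D) :
    ∃ M, Adapted (cosetInd a D (Nat.cast_pos.mpr hD)) D M := by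
  classical
  obtain ⟨M, hM, hb⟩ := exists_clear_denoms a
  choose b hb using hb
  refine ⟨M, hD, hM, fun x v => ?_, fun x hx i => ?_⟩
  · rw [StevensCocycle.cosetInd, tensor_latticeIndicator_apply, tensor_latticeIndicator_apply]
    refine if_congr (forall_congr' fun i => ⟨?_, ?_⟩) rfl rfl
    · rintro ⟨k, hk⟩
      refine ⟨k - v i, ?_⟩
      rw [Pi.add_apply] at hk
      push_cast
      linear_combination hk
    · rintro ⟨k, hk⟩
      refine ⟨k + v i, ?_⟩
      rw [Pi.add_apply]
      push_cast
      linear_combination hk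
  · rw [StevensCocycle.cosetInd, tensor_latticeIndicator_apply] at hx
    have hx' : ∀ i, ∃ k : ℤ, x i = a i + D * k := by
      by_contra h
      exact hx (if_neg h)
    obtain ⟨k, hk⟩ := hx' i
    refine ⟨b i + M * D * k, ?_⟩
    rw [hk]
    push_cast
    linear_combination hb i

/-- A rule which assigns elements of `G` to the cosets `a + d ℤⁿ`, compatible with the
decomposition of such a coset into cosets of `d e ℤⁿ`. -/
structure CosetRule (n : ℕ) (G : Type*) [AddCommGroup G] where
  toFun : Vec n → ℕ → G
  periodic : ∀ a (d : ℕ) (v : Fin n → ℤ), 0 < d →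
    toFun (a + fun i => (d : ℚ) * (v i : ℚ)) d = toFun a d
  subdivide : ∀ a (d e : ℕ), 0 < d → 0 < e → toFun a d =
    ∑ v ∈ Fintype.piFinset fun _ : Fin n => Finset.range e,
      toFun (a + fun i => (d : ℚ) * (v i : ℚ)) (d * e)

/-! ### Extension of rules on cosets to all test functions -/

variable {n : ℕ} {G : Type*} [AddCommGroup G]

theorem Adapted.sum_mul_right {f : TestFun n} {D M : ℕ} (h : Adapted f D M) {N : ℕ} (hN : 0 < N)
    (φ : Vec n → G) :
    ∑ a ∈ grid n D (M * N), f.1 a • φ a = ∑ a ∈ grid n D M, f.1 a • φ a := by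
  symm
  refine Finset.sum_subset (fun a ha => ?_) fun a ha ha' => ?_
  · rw [mem_grid (Nat.mul_pos h.denom_pos hN)]
    rw [mem_grid h.denom_pos] at ha
    intro i
    obtain ⟨h0, h1, k, hk⟩ := ha i
    refine ⟨h0, h1, N * k, ?_⟩
    push_cast
    rw [← hk]
    ring
  · have h0 : f.1 a = 0 := by
      by_contra h1
      rw [mem_grid (Nat.mul_pos h.denom_pos hN)] at ha
      refine ha' ((mem_grid h.denom_pos).mpr fun i => ?_)
      exact ⟨(ha i).1, (ha i).2.1, h.support a h1 i⟩
    rw [h0, zero_smul]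

/-- The map (a, v) ↦ a + D v is a bijection from grid points of [0, D)ⁿ and v ∈ {0, …, E-1}ⁿ to grid
points of [0, DE)ⁿ. As f has period D, the claim is the subdivision axiom summed over a. -/
theorem Adapted.sum_mul_left (φ : CosetRule n G) {f : TestFun n} {D M : ℕ} (h : Adapted f D M)
    {E : ℕ} (hE : 0 < E) :
    ∑ a ∈ grid n (D * E) M, f.1 a • φ.toFun a (D * E) =
      ∑ a ∈ grid n D M, f.1 a • φ.toFun a D := by
  have hD' : (0 : ℚ) < D := Nat.cast_pos.mpr h.period_pos
  have hE' : (0 : ℚ) < E := Nat.cast_pos.mpr hE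
  have h1 : ∀ a ∈ grid n D M, f.1 a • φ.toFun a D =
      ∑ v ∈ Fintype.piFinset fun _ : Fin n => Finset.range E,
        f.1 (a + fun i => (D : ℚ) * (v i : ℚ)) •
          φ.toFun (a + fun i => (D : ℚ) * (v i : ℚ)) (D * E) := by
    intro a _
    rw [φ.subdivide a D E h.period_pos hE, Finset.smul_sum]
    refine Finset.sum_congr rfl fun v _ => ?_
    have h2 := h.periodic a fun i => (v i : ℤ)
    simp only [Int.cast_natCast] at h2
    rw [h2]
  rw [Finset.sum_congr rfl h1, ← Finset.sum_product']
  symm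
  refine Finset.sum_bij (fun p _ => p.1 + fun i => (D : ℚ) * (p.2 i : ℚ)) ?_ ?_ ?_
    fun _ _ => rfl
  · rintro ⟨a, v⟩ hp
    obtain ⟨ha, hv⟩ := Finset.mem_product.mp hp
    rw [mem_grid h.denom_pos] at ha ⊢
    intro i
    obtain ⟨h0, h1, k, hk⟩ := ha i
    have hvi : (v i : ℚ) + 1 ≤ E := by
      exact_mod_cast Finset.mem_range.mp (Fintype.mem_piFinset.mp hv i)
    refine ⟨add_nonneg h0 (by positivity), ?_, k + M * D * v i, ?_⟩
    · have := mul_le_mul_of_nonneg_left hvi hD'.le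
      simp only [Pi.add_apply]
      push_cast
      linarith
    · simp only [Pi.add_apply]
      push_cast
      linear_combination hk
  · rintro ⟨a, v⟩ hp ⟨b, w⟩ hq hpq
    obtain ⟨ha, hv⟩ := Finset.mem_product.mp hp
    obtain ⟨hb, hw⟩ := Finset.mem_product.mp hq
    rw [mem_grid h.denom_pos] at ha hb
    have key : ∀ i, v i = w i := by
      intro i
      have h2 : a i + (D : ℚ) * v i = b i + D * w i := congrFun hpq i
      have h3 := eq_of_box ⟨(ha i).1, (ha i).2.1⟩ ⟨(hb i).1, (hb i).2.1⟩ ((w i : ℤ) - v i) (by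
        push_cast
        linear_combination h2)
      omega
    have hvw : v = w := funext key
    subst hvw
    exact Prod.ext (add_right_cancel hpq) rfl
  · intro x hx
    rw [mem_grid h.denom_pos] at hx
    have hfl : ∀ i, 0 ≤ ⌊x i / D⌋ := fun i => Int.floor_nonneg.mpr (div_nonneg (hx i).1 hD'.le)
    have hcast : ∀ i, ((⌊x i / D⌋.toNat : ℕ) : ℚ) = (⌊x i / D⌋ : ℚ) := fun i => by
      rw [← Int.cast_natCast, Int.toNat_of_nonneg (hfl i)]
    refine ⟨(boxRep D x, fun i => ⌊x i / D⌋.toNat), ?_, ?_⟩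
    · refine Finset.mem_product.mpr ⟨(mem_grid h.denom_pos).mpr fun i => ?_,
        Fintype.mem_piFinset.mpr fun i => ?_⟩
      · have hb := boxRep_bounds h.period_pos x i
        obtain ⟨-, -, k, hk⟩ := hx i
        refine ⟨hb.1, hb.2, k - M * D * ⌊x i / D⌋, ?_⟩
        simp only [boxRep]
        push_cast
        linear_combination hk
      · rw [Finset.mem_range, Int.toNat_lt (hfl i), Int.floor_lt, div_lt_iff₀ hD']
        have := (hx i).2.1
        push_cast at this ⊢
        linarith
    · simp only [hcast]
      exact boxRep_add D x

theorem Adapted.sum_eq (φ : CosetRule n G) {f : TestFun n} {D M D' M' : ℕ} (h : Adapted f D M)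
    (h' : Adapted f D' M') :
    ∑ a ∈ grid n D M, f.1 a • φ.toFun a D = ∑ a ∈ grid n D' M', f.1 a • φ.toFun a D' := by
  have key : ∀ {D M D' M' : ℕ}, Adapted f D M → Adapted f D' M' →
      ∑ a ∈ grid n (D * D') (M * M'), f.1 a • φ.toFun a (D * D') =
        ∑ a ∈ grid n D M, f.1 a • φ.toFun a D := by
    intro D M D' M' h h'
    rw [(h.mul h'.period_pos one_pos |>.of_dvd (Nat.mul_pos h.period_pos h'.period_pos)
      h.denom_pos dvd_rfl (by simp)).sum_mul_right h'.denom_pos,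
      h.sum_mul_left φ h'.period_pos]
  rw [← key h h', ← key h' h, mul_comm D, mul_comm M]

theorem CosetRule.exists_hom (φ : CosetRule n G) :
    ∃ μ : TestFun n →+ G, ∀ f D M, Adapted f D M →
      μ f = ∑ a ∈ grid n D M, f.1 a • φ.toFun a D := by
  choose D M h using fun f : TestFun n => exists_adapted f
  refine ⟨AddMonoidHom.mk' (fun f => ∑ a ∈ grid n (D f) (M f), f.1 a • φ.toFun a (D f)) ?_,
    fun f D' M' h' => (h f).sum_eq φ h'⟩
  intro f g
  -- With a common period and denominator the three sums run over the same grid, and additivity is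
  -- termwise.
  obtain ⟨D', M', h'⟩ := exists_adapted_family ![f, g, f + g]
  have hf : Adapted f D' M' := h' 0
  have hg : Adapted g D' M' := h' 1
  have hfg : Adapted (f + g) D' M' := h' 2
  rw [(h f).sum_eq φ hf, (h g).sum_eq φ hg, (h (f + g)).sum_eq φ hfg, ← Finset.sum_add_distrib]
  exact Finset.sum_congr rfl fun a _ => add_smul _ _ _

/-- The coset of a meets the grid only in the box representative of a, and the rule is periodic. -/
theorem CosetRule.hom_cosetInd (φ : CosetRule n G) {μ : TestFun n →+ G}
    (hμ : ∀ f D M, Adapted f D M → μ f = ∑ a ∈ grid n D M, f.1 a • φ.toFun a D)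
    (a : Vec n) {D : ℕ} (hD : 0 < D) :
    μ (cosetInd a D (Nat.cast_pos.mpr hD)) = φ.toFun a D := by
  classical
  obtain ⟨M, h⟩ := Adapted.cosetInd a hD
  have hind : ∀ x, (cosetInd a D (Nat.cast_pos.mpr hD)).1 x =
      if ∀ i, ∃ k : ℤ, x i = a i + D * k then 1 else 0 := fun x => by
    rw [cosetInd, tensor_latticeIndicator_apply]
  have h1 : (cosetInd a D (Nat.cast_pos.mpr hD)).1 (boxRep D a) = 1 := by
    rw [hind, if_pos]
    exact fun i => ⟨-⌊a i / D⌋, by simp only [boxRep]; push_cast; ring⟩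
  rw [hμ _ D M h, Finset.sum_eq_single (boxRep D a)]
  · rw [h1, one_smul]
    conv_rhs => rw [← boxRep_add D a]
    exact (φ.periodic _ _ _ hD).symm
  · intro b hb hne
    rw [hind, if_neg, zero_smul]
    intro hx
    apply hne
    funext i
    obtain ⟨k, hk⟩ := hx i
    have hb' := (mem_grid h.denom_pos).mp hb i
    have h2 : b i = boxRep D a i + D * (k + ⌊a i / D⌋ : ℤ) := by
      simp only [boxRep]
      push_cast
      linear_combination hk
    rw [h2, eq_of_box ⟨hb'.1, hb'.2.1⟩ (boxRep_bounds hD a i) _ h2]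
    simp
  · intro hx
    refine absurd ((mem_grid h.denom_pos).mpr fun i => ?_) hx
    have hb := boxRep_bounds hD a i
    exact ⟨hb.1, hb.2, h.support _ (by rw [h1]; exact one_ne_zero) i⟩

/-! ### The Kubota–Leopoldt distribution -/

theorem sum_piFinset_one {α G : Type*} [AddCommMonoid G] (s : Finset α) (g : (Fin 1 → α) → G) :
    ∑ v ∈ Fintype.piFinset (fun _ : Fin 1 => s), g v = ∑ j ∈ s, g fun _ => j := by
  refine Finset.sum_nbij' (fun v => v 0) (fun j _ => j) ?_ ?_ ?_ ?_ ?_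
  · exact fun v hv => Fintype.mem_piFinset.mp hv 0
  · exact fun j hj => Fintype.mem_piFinset.mpr fun _ => hj
  · exact fun v _ => funext fun i => congrArg v (Subsingleton.elim 0 i)
  · exact fun _ _ => rfl
  · exact fun v _ => congrArg g (funext fun i => congrArg v (Subsingleton.elim i 0))

theorem covecPull_smul {n m : ℕ} (A : Matrix (Fin n) (Fin m) ℚ) (c : ℚ) (l : Covec m) :
    covecPull A (c • l) = c • covecPull A l := LinearMap.smul_comp _ _ _

theorem proj_ne_zero {n : ℕ} (i : Fin n) : (LinearMap.proj i : Covec n) ≠ 0 := by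
  intro h
  have := LinearMap.congr_fun h (Pi.single i 1)
  simp at this

theorem cosetInd_one (a : Vec 1) {d : ℚ} (hd : 0 < d) :
    cosetInd a d hd = latticeIndicator (a 0) d hd := by
  refine Subtype.ext (funext fun x => ?_)
  change ∏ i : Fin 1, (latticeIndicator (a i) d hd).1 (fun _ => x i) = _
  rw [Fin.prod_univ_one]
  rfl

theorem latticeIndicator_eq_sum (a d : ℚ) (hd : 0 < d) {q : ℕ} (hq : 0 < q) (hqd : 0 < q * d) :
    latticeIndicator a d hd = ∑ j ∈ Finset.range q, latticeIndicator (a + j * d) (q * d) hqd := by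
  classical
  refine Subtype.ext (funext fun x => ?_)
  rw [AddSubgroup.val_finsetSum, Finset.sum_apply]
  simp only [latticeIndicator_apply]
  -- The point a + dk lies in exactly one of the q finer cosets, the one indexed by the residue of k
  -- modulo q.
  have key : ∀ (k : ℤ) (j : ℕ), j < q → x 0 = a + d * k →
      ((∃ k' : ℤ, x 0 = a + j * d + q * d * k') ↔ j = (k % q).toNat) := by
    intro k j hj hk
    have hq' : (0 : ℤ) < q := by exact_mod_cast hq
    have h0 := Int.emod_nonneg k hq'.ne'
    have hdiv := Int.emod_add_mul_ediv k q
    constructor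
    · rintro ⟨k', hk'⟩
      have h1 : d * (k - j - q * k') = 0 := by linear_combination hk' - hk
      have h2 : (k : ℚ) = j + q * k' := by
        have := (mul_eq_zero.mp h1).resolve_left hd.ne'
        linear_combination this
      have h3 : k = j + q * k' := by exact_mod_cast h2
      rw [h3, Int.add_mul_emod_self_left, Int.emod_eq_of_lt (by omega) (by omega)]
      simp
    · intro h
      refine ⟨k / q, ?_⟩
      have h4 : (j : ℤ) = k % q := by omega
      have h5 : (k : ℚ) = j + q * (k / q : ℤ) := by
        have : k = j + q * (k / q) := by rw [h4]; exact hdiv.symm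
        exact_mod_cast this
      rw [hk]
      linear_combination d * h5
  split_ifs with h
  · obtain ⟨k, hk⟩ := h
    have hq' : (0 : ℤ) < q := by exact_mod_cast hq
    have h0 := Int.emod_nonneg k hq'.ne'
    have h1 := Int.emod_lt_of_pos k hq'
    rw [Finset.sum_eq_single (k % q).toNat]
    · rw [if_pos ((key k _ (by omega) hk).mpr rfl)]
    · intro j hj hne
      rw [if_neg fun h => hne ((key k j (Finset.mem_range.mp hj) hk).mp h)]
    · intro h
      exact absurd (Finset.mem_range.mpr (by omega)) h
  · refine (Finset.sum_eq_zero fun j _ => if_neg ?_).symm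
    rintro ⟨k, hk⟩
    refine h ⟨j + q * k, ?_⟩
    push_cast
    linear_combination hk

/-- The unit `1 - exp(2πi(z_i - a)/d)` of `ℛ(V)`. -/
def coordUnit {n : ℕ} (i : Fin n) (a d : ℚ) : (TrigRing n)ˣ :=
  oneSub (a / d) (d⁻¹ • LinearMap.proj i)

theorem coordUnit_add {n : ℕ} (i : Fin n) (a : ℚ) {d : ℚ} (hd : d ≠ 0) (k : ℤ) :
    coordUnit i (a + d * k) d = coordUnit i a d := by
  rw [coordUnit, coordUnit, ← oneSub_add_int (a / d) k]
  congr 1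
  field_simp

theorem coordUnit_eq_prod {n : ℕ} (i : Fin n) (a : ℚ) {d : ℚ} (hd : d ≠ 0) {q : ℕ} (hq : 0 < q) :
    coordUnit i a d = ∏ j ∈ Finset.range q, coordUnit i (a + j * d) (q * d) := by
  have hq' : (q : ℚ) ≠ 0 := Nat.cast_ne_zero.mpr hq.ne'
  rw [coordUnit, oneSub_eq_prod _ _ hq]
  refine Finset.prod_congr rfl fun j _ => ?_
  rw [coordUnit, smul_smul, mul_inv]
  congr 1
  field_simp

/-- The values of the Kubota–Leopoldt distribution at cosets. -/
def kubotaLeopoldtRule : CosetRule 1 (Additive (CGroup 1)) where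
  toFun a d := Additive.ofMul ⟨coordUnit 0 (a 0) d, oneSub_mem _ _⟩
  periodic a d v hd := by
    refine congrArg Additive.ofMul (Subtype.ext ?_)
    exact coordUnit_add 0 (a 0) (Nat.cast_ne_zero.mpr hd.ne') (v 0)
  subdivide a d e hd he := by
    rw [sum_piFinset_one, ← ofMul_prod]
    refine congrArg Additive.ofMul (Subtype.ext ?_)
    rw [SubmonoidClass.coe_finsetProd]
    refine (coordUnit_eq_prod 0 (a 0) (Nat.cast_ne_zero.mpr hd.ne') he).trans ?_
    refine Finset.prod_congr rfl fun j _ => ?_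
    rw [Pi.add_apply, Nat.cast_mul, mul_comm (e : ℚ), mul_comm (j : ℚ)]

/-- A coset rule knows only integral d. A rational d is reached by splitting a + dℤ into q cosets of
qdℤ, with q the denominator of d and qd its numerator; the units obey the same product formula. -/
theorem exists_kubotaLeopoldt : ∃ η : Distr 1 (Additive (CGroup 1)), ∀ (a d : ℚ) (hd : 0 < d),
    η (latticeIndicator a d hd) = Additive.ofMul ⟨coordUnit 0 a d, oneSub_mem _ _⟩ := by
  obtain ⟨μ, hμ⟩ := kubotaLeopoldtRule.exists_hom
  have hnat : ∀ (a : ℚ) {D : ℕ} (hD : 0 < D), μ (latticeIndicator a D (Nat.cast_pos.mpr hD)) =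
      Additive.ofMul ⟨coordUnit 0 a D, oneSub_mem _ _⟩ := by
    intro a D hD
    have h := kubotaLeopoldtRule.hom_cosetInd hμ (fun _ => a) hD
    rwa [cosetInd_one] at h
  refine ⟨μ, fun a d hd => ?_⟩
  have hD : 0 < d.num.toNat := by
    have := Rat.num_pos.mpr hd
    omega
  have hnum : (d.den : ℚ) * d = (d.num.toNat : ℕ) := by
    rw [mul_comm, Rat.mul_den_eq_num, ← Int.cast_natCast,
      Int.toNat_of_nonneg (Rat.num_pos.mpr hd).le]
  have hqd : 0 < (d.den : ℚ) * d := mul_pos (Nat.cast_pos.mpr d.den_pos) hd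
  change μ _ = _
  rw [latticeIndicator_eq_sum a d hd d.den_pos hqd, map_sum]
  have h1 : ∀ b, μ (latticeIndicator b ((d.den : ℚ) * d) hqd) =
      Additive.ofMul ⟨coordUnit 0 b ((d.den : ℚ) * d), oneSub_mem _ _⟩ := by
    generalize (d.den : ℚ) * d = e at hqd hnum
    subst hnum
    exact fun b => hnat b hD
  simp only [h1, ← ofMul_prod]
  refine congrArg Additive.ofMul (Subtype.ext ?_)
  rw [SubmonoidClass.coe_finsetProd]
  exact (coordUnit_eq_prod 0 a hd.ne' d.den_pos).symm

theorem isKubotaLeopoldt_of_apply {η : Distr 1 (Additive (CGroup 1))}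
    (h : ∀ (a d : ℚ) (hd : 0 < d),
      η (latticeIndicator a d hd) = Additive.ofMul ⟨coordUnit 0 a d, oneSub_mem _ _⟩) :
    IsKubotaLeopoldt η := by
  intro a d hd
  rw [h a d hd]
  have hl : (d⁻¹ • LinearMap.proj 0 : Covec 1) ≠ 0 :=
    smul_ne_zero (inv_ne_zero hd.ne') (proj_ne_zero 0)
  refine (oneSub_val (a / d) hl).trans (funext fun z => ?_)
  simp only [Pi.sub_apply, Pi.one_apply, eps, evalC_smul, evalC_proj]
  congr 3
  push_cast
  ring

theorem covecPull_coordMatrix {n : ℕ} (i : Fin n) :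
    covecPull (Matrix.of fun (j : Fin n) (_ : Fin 1) => if j = i then (1 : ℚ) else 0)
      (LinearMap.proj 0) = LinearMap.proj i := by
  refine LinearMap.ext fun x => ?_
  simp [covecPull, Matrix.vecMul, dotProduct]

theorem etaCoord_latticeIndicator {η : Distr 1 (Additive (CGroup 1))}
    (h : ∀ (a d : ℚ) (hd : 0 < d),
      η (latticeIndicator a d hd) = Additive.ofMul ⟨coordUnit 0 a d, oneSub_mem _ _⟩)
    {n : ℕ} (i : Fin n) (a d : ℚ) (hd : 0 < d) :
    etaCoord η (latticeIndicator a d hd) i = coordUnit i a d := by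
  rw [etaCoord, h]
  refine (map_trigPull_oneSub _ (coordMatrix_ne_zero i) _ _).trans ?_
  rw [covecPull_smul, covecPull_coordMatrix, coordUnit]

/-- `f ↦ η(f)(z_i)` as an additive homomorphism. -/
def etaCoordHom {n : ℕ} (η : Distr 1 (Additive (CGroup 1))) (i : Fin n) :
    TestFun 1 →+ Additive (TrigRing n)ˣ :=
  (MonoidHom.toAdditive ((Units.map (coordPull i : TrigRing 1 →* TrigRing n)).comp
    (CGroup 1).subtype)).comp (η : TestFun 1 →+ Additive (CGroup 1))

theorem etaCoordHom_apply {n : ℕ} (η : Distr 1 (Additive (CGroup 1))) (i : Fin n)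
    (f : TestFun 1) : etaCoordHom η i f = Additive.ofMul (etaCoord η f i) := rfl

/-! ### The distribution attached to the standard basis -/

/-- The values of the Stevens distribution of the standard basis at cosets. -/
def stevensRule (n : ℕ) : CosetRule n (KTilde n n) where
  toFun a d := KTilde.multi n n fun i => Additive.ofMul (coordUnit i (a i) d)
  periodic a d v hd := by
    congr 1
    funext i
    rw [Pi.add_apply, coordUnit_add i (a i) (Nat.cast_ne_zero.mpr hd.ne')]
  subdivide a d e hd he := by
    -- The one-variable product formula is inserted in every slot, and the symbol is expanded
    -- multilinearly.
    refine Eq.trans ?_ (MultilinearMap.map_sum_finset (KTilde.multi n n)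
      (fun i (j : ℕ) => Additive.ofMul (coordUnit i (a i + d * j) ((d * e : ℕ) : ℚ)))
      (fun _ => Finset.range e))
    congr 1
    funext i
    rw [← ofMul_prod, coordUnit_eq_prod i (a i) (Nat.cast_ne_zero.mpr hd.ne') he]
    refine congrArg Additive.ofMul (Finset.prod_congr rfl fun j _ => ?_)
    rw [Nat.cast_mul, mul_comm (e : ℚ), mul_comm (j : ℚ)]

theorem exists_stevens_standard {η : Distr 1 (Additive (CGroup 1))}
    (h : ∀ (a d : ℚ) (hd : 0 < d),
      η (latticeIndicator a d hd) = Additive.ofMul ⟨coordUnit 0 a d, oneSub_mem _ _⟩) (n : ℕ) :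
    ∃ μ : Distr n (KTilde n n), ∀ fs : Fin n → TestFun 1,
      μ (tensor fs) = KTilde.symbol fun i => etaCoord η (fs i) i := by
  obtain ⟨μ, hμ⟩ := (stevensRule n).exists_hom
  refine ⟨μ, fun fs => ?_⟩
  obtain ⟨D, M, hfs⟩ := exists_adapted_family fs
  -- For n = 0 the family is empty and says nothing about positivity of D and M.
  obtain ⟨D, M, hD, hM, hfs⟩ : ∃ D M, 0 < D ∧ 0 < M ∧ ∀ i, Adapted (fs i) D M := by
    rcases isEmpty_or_nonempty (Fin n) with he | ⟨⟨i⟩⟩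
    · exact ⟨1, 1, one_pos, one_pos, fun i => he.elim i⟩
    · exact ⟨D, M, (hfs i).period_pos, (hfs i).denom_pos, hfs⟩
  change μ _ = _
  rw [hμ _ D M (Adapted.tensor hD hM hfs)]
  have h1 : (KTilde.symbol fun i => etaCoord η (fs i) i) =
      KTilde.multi n n fun i => etaCoordHom η i (fs i) := rfl
  have h2 : ∀ i, etaCoordHom η i (fs i) =
      ∑ t ∈ (Finset.range (D * M)).image fun k : ℕ => (k : ℚ) / M,
        (fs i).1 (fun _ => t) • Additive.ofMul (coordUnit i t D) := by
    intro i
    conv_lhs => rw [(hfs i).eq_sum]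
    rw [grid, sum_piFinset_one, map_sum]
    refine Finset.sum_congr rfl fun t _ => ?_
    rw [map_zsmul, cosetInd_one, etaCoordHom_apply, etaCoord_latticeIndicator h]
  rw [h1, funext h2, MultilinearMap.map_sum_finset]
  refine Finset.sum_congr rfl fun a _ => ?_
  rw [MultilinearMap.map_smul_univ]
  rfl

/-! ### Frames -/

theorem generalPosition_iff {n : ℕ} {l : Fin n → Covec n} :
    GeneralPosition l ↔ LinearIndependent ℚ l := by
  constructor
  · intro h
    have h1 := h Finset.univ (by simp)
    exact h1.comp (fun i : Fin n => (⟨i, Finset.mem_univ i⟩ : (Finset.univ : Finset (Fin n))))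
      fun i j hij => congrArg Subtype.val hij
  · exact fun h s _ => h.comp _ Subtype.val_injective

theorem covecAct_apply {n : ℕ} (g : GLQ n) (l : Covec n) (x : Vec n) :
    covecAct g l x = l (x ᵥ* (g : Matrix (Fin n) (Fin n) ℚ)) := rfl

/-- The matrix A with entries λ_i(e_j) in row j and column i satisfies λ_i(y) = (yA)_i. It is
invertible because its columns are independent, and γ = A⁻¹. -/
theorem exists_frame {n : ℕ} {l : Fin n → Covec n} (h : GeneralPosition l) :
    ∃ g : GLQ n, ∀ i, covecAct g (l i) = LinearMap.proj i := by
  have hA : ∀ (i : Fin n) (y : Vec n),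
      l i y = (y ᵥ* Matrix.of fun j i => l i (Pi.single j 1)) i := by
    intro i y
    rw [LinearMap.pi_apply_eq_sum_univ (l i) y]
    simp [Matrix.vecMul, dotProduct, ← Pi.single_apply, Pi.single_comm]
  have hu : IsUnit (Matrix.of fun j i => l i (Pi.single j 1)) := by
    rw [← Matrix.mulVec_injective_iff_isUnit]
    refine (injective_iff_map_eq_zero (Matrix.mulVecLin _)).mpr fun v hv => ?_
    have h0 : ∑ i, v i • l i = 0 := by
      refine LinearMap.pi_ext' fun j => LinearMap.ext_ring ?_
      have h1 := congrFun hv j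
      simpa [Matrix.mulVec, dotProduct, mul_comm] using h1
    exact funext (Fintype.linearIndependent_iff.mp (generalPosition_iff.mp h) v h0)
  obtain ⟨u, hu⟩ := hu
  refine ⟨u⁻¹, fun i => LinearMap.ext fun x => ?_⟩
  rw [covecAct_apply, hA, ← hu, Matrix.vecMul_vecMul, ← Units.val_mul, inv_mul_cancel]
  simp

theorem covecAct_inv {n : ℕ} {g : GLQ n} {l l' : Covec n} (h : covecAct g l = l') :
    covecAct g⁻¹ l' = l := by
  rw [← h, ← covecAct_mul, inv_mul_cancel, covecAct_one]

/-- The quotient g' g⁻¹ fixes all coordinate forms, so it is the identity matrix. -/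
theorem frame_unique {n : ℕ} {l : Fin n → Covec n} {g g' : GLQ n}
    (hg : ∀ i, covecAct g (l i) = LinearMap.proj i)
    (hg' : ∀ i, covecAct g' (l i) = LinearMap.proj i) : g = g' := by
  have h : ∀ i, covecAct (g' * g⁻¹) (LinearMap.proj i) = LinearMap.proj i := fun i => by
    rw [covecAct_mul, covecAct_inv (hg i), hg' i]
  have h1 : ((g' * g⁻¹ : GLQ n) : Matrix (Fin n) (Fin n) ℚ) = 1 := by
    ext j i
    have := LinearMap.congr_fun (h i) (Pi.single j 1)
    rw [covecAct_apply] at this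
    simpa [Matrix.one_apply, Pi.single_apply, eq_comm] using this
  exact (mul_inv_eq_one.mp (Units.ext h1)).symm

theorem generalPosition_of_frame {n : ℕ} {l : Fin n → Covec n} {g : GLQ n}
    (hg : ∀ i, covecAct g (l i) = LinearMap.proj i) : GeneralPosition l := by
  have h1 : GeneralPosition fun i : Fin n => (LinearMap.proj i : Covec n) := by
    refine generalPosition_iff.mpr (Fintype.linearIndependent_iff.mpr fun c hc i => ?_)
    have := LinearMap.congr_fun hc (Pi.single i 1)
    simpa [Pi.single_apply] using this
  have h2 := h1.act g⁻¹
  simp only [covecAct_inv (hg _)] at h2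
  exact h2

theorem frame_apply {n : ℕ} {l : Fin n → Covec n} {g : GLQ n}
    (hg : ∀ i, covecAct g (l i) = LinearMap.proj i) (i : Fin n) (x : Vec n) :
    l i (x ᵥ* (g : Matrix (Fin n) (Fin n) ℚ)) = x i :=
  LinearMap.congr_fun (hg i) x

/-! ### Cosets of lattices -/

open Classical in
/-- `f` is the characteristic function of the coset `{x | λ_i(x - a) ∈ ℤ for all i}`. -/
def IsCosetInd {n : ℕ} {ι : Type*} (f : TestFun n) (l : ι → Covec n) (a : Vec n) : Prop :=
  ∀ x, f.1 x = if ∀ i, ∃ k : ℤ, l i (x - a) = k then 1 else 0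

/-- The sign of b does not matter because ℤ = -ℤ; the absolute value supplies the positive period
that `latticeIndicator` requires. -/
theorem exists_int_abs_iff (b s : ℚ) (hb : b ≠ 0) (t : ℚ) :
    (∃ k : ℤ, b * (t - s) = k) ↔ ∃ k : ℤ, t = s + |b|⁻¹ * k := by
  rcases lt_or_gt_of_ne hb with h | h
  · rw [abs_of_neg h]
    constructor
    · rintro ⟨k, hk⟩
      refine ⟨-k, ?_⟩
      push_cast
      rw [← hk]
      field_simp
      ring
    · rintro ⟨k, hk⟩
      refine ⟨-k, ?_⟩
      rw [hk]
      push_cast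
      field_simp
      ring
  · rw [abs_of_pos h]
    constructor
    · rintro ⟨k, hk⟩
      refine ⟨k, ?_⟩
      rw [← hk]
      field_simp
      ring
    · rintro ⟨k, hk⟩
      refine ⟨k, ?_⟩
      rw [hk]
      field_simp
      ring

/-- The two decidability instances are independent arguments, so that indicators formed with
different instances can be compared. -/
theorem ite_one_zero_congr {p q : Prop} (hp : Decidable p) (hq : Decidable q) (h : p ↔ q) :
    (@ite ℤ p hp 1 0) = @ite ℤ q hq 1 0 := by
  by_cases hp : p
  · rw [if_pos hp, if_pos (h.mp hp)]
  · rw [if_neg hp, if_neg fun hq => hp (h.mpr hq)]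

theorem IsCosetInd.act_eq_tensor {n : ℕ} {l : Fin n → Covec n} {g : GLQ n}
    (hg : ∀ i, covecAct g (l i) = LinearMap.proj i) {b : Fin n → ℚ} (hb : ∀ i, b i ≠ 0)
    {a : Vec n} {f : TestFun n} (hf : IsCosetInd f (fun i => b i • l i) a) :
    TestFun.act g f =
      tensor fun i => latticeIndicator (l i a) |b i|⁻¹ (inv_pos.mpr (abs_pos.mpr (hb i))) := by
  classical
  refine Subtype.ext (funext fun x => ?_)
  rw [tensor_latticeIndicator_apply]
  refine (hf _).trans (ite_one_zero_congr _ _ (forall_congr' fun i => ?_))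
  rw [LinearMap.smul_apply, map_sub, frame_apply hg, smul_eq_mul]
  exact exists_int_abs_iff _ _ (hb i) _

theorem isCosetInd_act_inv {n : ℕ} {l : Fin n → Covec n} {g : GLQ n}
    (hg : ∀ i, covecAct g (l i) = LinearMap.proj i) (a : Vec n) (d : ℚ) (hd : 0 < d) :
    IsCosetInd (TestFun.act g⁻¹ (cosetInd a d hd)) (fun i => d⁻¹ • l i)
      (a ᵥ* (g : Matrix (Fin n) (Fin n) ℚ)) := by
  classical
  intro x
  refine (tensor_latticeIndicator_apply _ _ _ _).trans
    (ite_one_zero_congr _ _ (forall_congr' fun i => ?_))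
  have h1 : l i x = (x ᵥ* ((g⁻¹ : GLQ n) : Matrix (Fin n) (Fin n) ℚ)) i := by
    rw [← frame_apply hg i (x ᵥ* ((g⁻¹ : GLQ n) : Matrix (Fin n) (Fin n) ℚ)),
      Matrix.vecMul_vecMul, ← Units.val_mul, inv_mul_cancel,
      Units.val_one, Matrix.vecMul_one]
  rw [LinearMap.smul_apply, map_sub, frame_apply hg, h1, smul_eq_mul,
    exists_int_abs_iff _ _ (inv_ne_zero hd.ne'), abs_of_pos (inv_pos.mpr hd), inv_inv]

theorem TestFun.act_inv_act {n : ℕ} (g : GLQ n) (f : TestFun n) :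
    TestFun.act g⁻¹ (TestFun.act g f) = f := by
  refine Subtype.ext (funext fun x => ?_)
  change f.1 (x ᵥ* _ ᵥ* _) = f.1 x
  rw [Matrix.vecMul_vecMul, ← Units.val_mul, inv_mul_cancel, Units.val_one, Matrix.vecMul_one]

/-- The cosets of the lattices `d L`, where `L` is the dual lattice of a basis, generate
the group of test functions. -/
theorem Distr.ext_coset {n : ℕ} {M : Type} [AddCommGroup M] {l : Fin n → Covec n}
    (hl : GeneralPosition l) {μ ν : Distr n M}
    (H : ∀ d : ℕ, 0 < d → ∀ a f, IsCosetInd f (fun i => (d : ℚ)⁻¹ • l i) a → μ f = ν f) :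
    μ = ν := by
  obtain ⟨g, hg⟩ := exists_frame hl
  refine DFunLike.ext _ _ fun f => ?_
  obtain ⟨D, N, h⟩ := exists_adapted (TestFun.act g f)
  rw [← TestFun.act_inv_act g f, h.eq_sum, map_sum, map_sum, map_sum]
  refine Finset.sum_congr rfl fun a _ => ?_
  rw [map_zsmul, map_zsmul, map_zsmul,
    H D h.period_pos _ _ (isCosetInd_act_inv hg a D (Nat.cast_pos.mpr h.period_pos))]

/-- Evaluation of distributions at a test function. -/
def Distr.eval {n : ℕ} {M : Type} [AddCommGroup M] (f : TestFun n) : Distr n M →+ M :=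
  (AddMonoidHom.eval f : (TestFun n →+ M) →+ M)

/-! ### The Stevens distributions of all bases -/

open Classical in
/-- The translate of `μ` to the basis `λ`; it is `0` for tuples which are not a basis. -/
def translate {n : ℕ} {M : Type} [AddCommGroup M] [DistribMulAction (GLQ n)ᵐᵒᵖ M]
    (μ : Distr n M) (l : Fin n → Covec n) : Distr n M :=
  if h : GeneralPosition l then μ <• (exists_frame h).choose else 0

section Translate

variable {n : ℕ} {M : Type} [AddCommGroup M] [DistribMulAction (GLQ n)ᵐᵒᵖ M] (μ : Distr n M)

theorem translate_of_not {l : Fin n → Covec n} (h : ¬ GeneralPosition l) : translate μ l = 0 := by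
  rw [translate, dif_neg h]

theorem translate_eq {l : Fin n → Covec n} {g : GLQ n}
    (hg : ∀ i, covecAct g (l i) = LinearMap.proj i) : translate μ l = μ <• g := by
  have h := generalPosition_of_frame hg
  rw [translate, dif_pos h, frame_unique (exists_frame h).choose_spec hg]

/-- If k is the frame of λ, then k g⁻¹ is the frame of g · λ. A tuple that is not a basis stays so
under g, and both sides are zero. -/
theorem translate_act (g : GLQ n) (l : Fin n → Covec n) :
    translate μ (fun i => covecAct g (l i)) <• g = translate μ l := by
  by_cases h : GeneralPosition l
  · obtain ⟨k, hk⟩ := exists_frame h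
    have hk' : ∀ i, covecAct (k * g⁻¹) (covecAct g (l i)) = LinearMap.proj i := fun i => by
      rw [← covecAct_mul, inv_mul_cancel_right, hk]
    rw [translate_eq μ hk, translate_eq μ hk', smul_smul, ← MulOpposite.op_mul,
      inv_mul_cancel_right]
  · rw [translate_of_not μ h, translate_of_not, smul_zero]
    intro h'
    apply h
    have h2 := h'.act g⁻¹
    simp only [← covecAct_mul, inv_mul_cancel, covecAct_one] at h2
    exact h2

end Translate

section Stevens

variable {n : ℕ} {η : Distr 1 (Additive (CGroup 1))} {μ : Distr n (KTilde n n)}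

theorem translate_tensor (hμ : ∀ fs : Fin n → TestFun 1,
      μ (tensor fs) = KTilde.symbol fun i => etaCoord η (fs i) i)
    {l : Fin n → Covec n} {g : GLQ n} (hg : ∀ i, covecAct g (l i) = LinearMap.proj i)
    {f : TestFun n} {fs : Fin n → TestFun 1} (hf : TestFun.act g f = tensor fs) :
    translate μ l f = KTilde.symbol (fun i => etaCoord η (fs i) i) <• g := by
  rw [translate_eq μ hg, ← hμ, ← hf]
  rfl

/-- The value of a Stevens distribution at the characteristic function of a coset. -/
theorem translate_coset
    (hη : ∀ (a d : ℚ) (hd : 0 < d),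
      η (latticeIndicator a d hd) = Additive.ofMul ⟨coordUnit 0 a d, oneSub_mem _ _⟩)
    (hμ : ∀ fs : Fin n → TestFun 1,
      μ (tensor fs) = KTilde.symbol fun i => etaCoord η (fs i) i)
    {l : Fin n → Covec n} (hl : GeneralPosition l) {b : Fin n → ℚ} (hb : ∀ i, b i ≠ 0)
    {a : Vec n} {f : TestFun n} (hf : IsCosetInd f (fun i => b i • l i) a) :
    KTilde.toKQuot n n (translate μ l f) =
      wedge n n fun i => oneSubClass ((b i • l i) a, b i • l i) := by
  obtain ⟨g, hg⟩ := exists_frame hl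
  rw [translate_tensor hμ hg (hf.act_eq_tensor hg hb)]
  have h1 : (KTilde.symbol fun i => etaCoord η (latticeIndicator (l i a) |b i|⁻¹
      (inv_pos.mpr (abs_pos.mpr (hb i)))) i) <• g =
      (KTilde.symbol fun i => oneSub (|b i| * l i a) (|b i| • l i) : KTilde n n) := by
    refine (KTilde.act_symbol g _).trans ?_
    congr 1
    funext i
    rw [etaCoord_latticeIndicator hη, coordUnit]
    refine (map_trigPull_oneSub _ (covecAct_ne_zero g⁻¹) _ _).trans ?_
    rw [covecPull_smul, inv_inv, div_inv_eq_mul, mul_comm]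
    congr 2
    exact covecAct_inv (hg i)
  rw [h1, KTilde.toKQuot_oneSub (fun i => (|b i| * l i a, |b i| • l i))]
  congr 1
  funext i
  -- The absolute values come from the positive periods of the coset; parity of x(w) removes them.
  rcases abs_cases (b i) with h | h
  · rw [h.1]
    rfl
  · rw [h.1, ← oneSubClass_neg]
    congr 1
    ext1 <;> simp

/-- On a coset attached to λ', both sides are the same product, which depends only on the rescaled
covectors. Negative scalars are allowed too. -/
theorem translate_smul
    (hη : ∀ (a d : ℚ) (hd : 0 < d),
      η (latticeIndicator a d hd) = Additive.ofMul ⟨coordUnit 0 a d, oneSub_mem _ _⟩)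
    (hμ : ∀ fs : Fin n → TestFun 1,
      μ (tensor fs) = KTilde.symbol fun i => etaCoord η (fs i) i)
    {l l' : Fin n → Covec n} (hl : GeneralPosition l) (hl' : GeneralPosition l') {b : Fin n → ℚ}
    (hb : ∀ i, b i ≠ 0) (h : ∀ i, l' i = b i • l i) : translate μ l' = translate μ l := by
  refine Distr.ext_coset hl' fun d hd a f hf => KTilde.toKQuot_injective n n ?_
  have hd' : (d : ℚ)⁻¹ ≠ 0 := inv_ne_zero (Nat.cast_ne_zero.mpr hd.ne')
  rw [translate_coset hη hμ hl' (fun _ => hd') hf]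
  simp only [h, smul_smul] at hf ⊢
  rw [translate_coset hη hμ hl (fun i => mul_ne_zero hd' (hb i)) hf]

end Stevens

/-! ### The cocycle relation -/

/-- Linear relations among `m + 2` covectors on `ℚ^{m+1}` which span the dual space. -/
theorem exists_relation {m : ℕ} {l : Fin (m + 2) → Covec (m + 1)} {i₀ : Fin (m + 2)}
    (h₀ : GeneralPosition fun j => l (i₀.succAbove j)) :
    ∃ c : Fin (m + 2) → ℚ, ∑ i, c i • l i = 0 ∧
      ∀ i, GeneralPosition (fun j => l (i.succAbove j)) ↔ c i ≠ 0 := by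
  have hdep : ¬ LinearIndependent ℚ l := by
    intro h
    have := h.fintype_card_le_finrank
    simp at this
  obtain ⟨c, hc, i₁, hi₁⟩ := Fintype.not_linearIndependent_iff.mp hdep
  -- With c i = 0 the relation would live on an independent face, so all coefficients would vanish.
  -- Conversely, if c i ≠ 0 then λ_i lies in the span of the others, which thus span the dual space.
  have hne : ∀ i, GeneralPosition (fun j => l (i.succAbove j)) → c i ≠ 0 := by
    intro i hi h0
    rw [Fin.sum_univ_succAbove _ i, h0, zero_smul, zero_add] at hc
    have h1 := Fintype.linearIndependent_iff.mp (generalPosition_iff.mp hi) _ hc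
    rcases Fin.eq_self_or_eq_succAbove i i₁ with rfl | ⟨j, rfl⟩
    · exact hi₁ h0
    · exact hi₁ (h1 j)
  have hspan : Submodule.span ℚ (Set.range l) = ⊤ := by
    refine top_le_iff.mp ?_
    rw [← (generalPosition_iff.mp h₀).span_eq_top_of_card_eq_finrank (by simp)]
    exact Submodule.span_mono (Set.range_comp_subset_range _ l)
  refine ⟨c, hc, fun i => ⟨hne i, fun hci => generalPosition_iff.mpr ?_⟩⟩
  refine linearIndependent_of_top_le_span_of_card_eq_finrank ?_ (by simp)
  rw [← hspan, Submodule.span_le]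
  rintro _ ⟨k, rfl⟩
  have hmem : ∀ j, l (i.succAbove j) ∈
      Submodule.span ℚ (Set.range fun j => l (i.succAbove j)) :=
    fun j => Submodule.subset_span ⟨j, rfl⟩
  rcases Fin.eq_self_or_eq_succAbove i k with rfl | ⟨j, rfl⟩
  · rw [Fin.sum_univ_succAbove _ k, add_eq_zero_iff_eq_neg] at hc
    have h2 : l k = (c k)⁻¹ • -∑ j, c (k.succAbove j) • l (k.succAbove j) := by
      rw [← hc, smul_smul, inv_mul_cancel₀ hci, one_smul]
    rw [SetLike.mem_coe, h2]
    exact Submodule.smul_mem _ _ (Submodule.neg_mem _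
      (Submodule.sum_mem _ fun j _ => Submodule.smul_mem _ _ (hmem j)))
  · exact hmem j

/-- The `K`-theoretic relation behind the cocycle property. -/
theorem sum_wedge_eq_zero {n k : ℕ} (w : Fin (k + 1) → ℚ × Covec n) (I : Finset (Fin (k + 1)))
    (hsum : ∑ i ∈ I, w i = 0) (i₀ : Fin (k + 1)) (hi₀ : i₀ ∈ I) (hw : w i₀ ≠ 0)
    (hli : LinearIndependent ℚ fun j => (w (i₀.succAbove j)).2) :
    ∑ i : Fin (k + 1), (-1 : ℤ) ^ (i : ℕ) • (if i ∈ I then (1 : ℤ) else 0) •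
      wedge n k (fun j => oneSubClass (w (i.succAbove j))) = 0 := by
  refine sum_alternatingMap_succAbove (wedge n k) (fun i => oneSubClass (w i))
    (fun i => if i ∈ I then (1 : ℤ) else 0) i₀ (if_pos hi₀) ?_
  set J : Finset (Fin k) := Finset.univ.filter fun j => i₀.succAbove j ∈ I with hJdef
  have hsum' : w i₀ + ∑ j ∈ J, w (i₀.succAbove j) = 0 := by
    rw [← hsum, ← Finset.sum_ite_mem_eq I, Fin.sum_univ_succAbove _ i₀, if_pos hi₀, hJdef,
      Finset.sum_filter]
  have hJ : J.Nonempty := by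
    rw [Finset.nonempty_iff_ne_empty]
    intro h
    rw [h, Finset.sum_empty, add_zero] at hsum'
    exact hw hsum'
  refine alternatingMap_eq_zero_of_sum (wedge n k) oneSubClass (fun w => w.2 ≠ 0) ?_ J hJ
    (fun j => w (i₀.succAbove j)) ?_ _ ?_
  · intro v p q w w' hpq h h' hs hp hq
    refine wedge_eq_zero v hpq ?_
    rw [hp, hq]
    exact oneSubClass_mul w w' h h' hs
  -- A nonempty partial sum of independent covectors is nonzero.
  · intro s _ hs h0
    obtain ⟨j, hj⟩ := hs
    have h1 := linearIndependent_iff'.mp hli s (fun _ => 1) (by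
      rw [Prod.snd_sum] at h0
      simpa using h0) j hj
    exact one_ne_zero h1
  · intro j hj
    have hj' : i₀.succAbove j ∈ I := (Finset.mem_filter.mp hj).2
    -- As w i₀ is minus the sum over J, parity turns x(w i₀) into x of that sum.
    rw [if_pos hj', one_smul, eq_neg_of_add_eq_zero_left hsum', oneSubClass_neg]

variable {η : Distr 1 (Additive (CGroup 1))}

/-- Only nonvanishing of the covectors is assumed, since group elements may produce degenerate
tuples. A zero covector must be excluded: if the other n form a basis, a single term of the sum
would remain. -/
theorem sum_translate_eq_zero {m : ℕ} {μ : Distr (m + 1) (KTilde (m + 1) (m + 1))}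
    (hη : ∀ (a d : ℚ) (hd : 0 < d),
      η (latticeIndicator a d hd) = Additive.ofMul ⟨coordUnit 0 a d, oneSub_mem _ _⟩)
    (hμ : ∀ fs : Fin (m + 1) → TestFun 1,
      μ (tensor fs) = KTilde.symbol fun i => etaCoord η (fs i) i)
    (l : Fin (m + 2) → Covec (m + 1)) (hl : ∀ i, l i ≠ 0) :
    ∑ i : Fin (m + 2), (-1 : ℤ) ^ (i : ℕ) • translate μ (fun j => l (i.succAbove j)) = 0 := by
  classical
  by_cases hex : ∃ i₀ : Fin (m + 2), GeneralPosition fun j => l (i₀.succAbove j)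
  swap
  · refine Finset.sum_eq_zero fun i _ => ?_
    rw [translate_of_not μ fun h => hex ⟨i, h⟩, smul_zero]
  obtain ⟨i₀, h₀⟩ := hex
  obtain ⟨c, hc, hcGP⟩ := exists_relation h₀
  -- The value 1 outside I keeps every scaling factor invertible; it does not enter the relation.
  set b : Fin (m + 2) → ℚ := fun i => if c i = 0 then 1 else c i with hb
  have hb0 : ∀ i, b i ≠ 0 := by
    intro i
    by_cases h : c i = 0 <;> simp [hb, h]
  set I : Finset (Fin (m + 2)) := Finset.univ.filter fun i => c i ≠ 0 with hI
  have hmemI : ∀ i, i ∈ I ↔ c i ≠ 0 := fun i => by simp [hI]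
  have hsum : ∑ i ∈ I, b i • l i = 0 := by
    rw [hI, Finset.sum_filter]
    refine (Finset.sum_congr rfl fun i _ => ?_).trans hc
    by_cases h : c i = 0 <;> simp [hb, h]
  have h₀' : GeneralPosition fun j => b (i₀.succAbove j) • l (i₀.succAbove j) :=
    generalPosition_iff.mpr ((generalPosition_iff.mp h₀).units_smul
      fun j => Units.mk0 _ (hb0 (i₀.succAbove j)))
  refine Distr.ext_coset h₀' fun d hd a f hf => ?_
  have hd' : (d : ℚ)⁻¹ ≠ 0 := inv_ne_zero (Nat.cast_ne_zero.mpr hd.ne')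
  set L : Fin (m + 2) → Covec (m + 1) := fun i => ((d : ℚ)⁻¹ * b i) • l i with hL
  have hsumL : ∑ i ∈ I, L i = 0 := by
    simp only [hL, ← smul_smul, ← Finset.smul_sum, hsum, smul_zero]
  -- For i ∈ I, L i is minus the sum of the other L j with j ∈ I, so it takes an integral value
  -- wherever they all do. All faces opposite to an index in I thus define the same coset.
  have hfull : ∀ i ∈ I, ∀ x : Vec (m + 1), (∀ j, ∃ k : ℤ, L (i.succAbove j) (x - a) = k) ↔
      ∀ j, ∃ k : ℤ, L j (x - a) = k := by
    intro i hi x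
    refine ⟨fun h j => ?_, fun h j => h _⟩
    rcases Fin.eq_self_or_eq_succAbove i j with rfl | ⟨j, rfl⟩
    · choose k hk using h
      have h1 := LinearMap.congr_fun hsumL (x - a)
      rw [← Finset.sum_ite_mem_eq, Fin.sum_univ_succAbove _ j, if_pos hi] at h1
      refine ⟨-∑ t, if j.succAbove t ∈ I then k t else 0, ?_⟩
      rw [LinearMap.add_apply, LinearMap.sum_apply, LinearMap.zero_apply,
        add_eq_zero_iff_eq_neg] at h1
      rw [h1]
      push_cast
      refine congrArg Neg.neg (Finset.sum_congr rfl fun t _ => ?_)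
      split_ifs
      · exact hk t
      · rfl
    · exact h j
  have hf₀ : IsCosetInd f (fun j => L (i₀.succAbove j)) a := by
    simpa only [smul_smul] using hf
  have hfi : ∀ i ∈ I, IsCosetInd f (fun j => L (i.succAbove j)) a := by
    intro i hi x
    rw [hf₀ x]
    exact ite_one_zero_congr _ _
      ((hfull i₀ ((hmemI i₀).mpr ((hcGP i₀).mp h₀)) x).trans (hfull i hi x).symm)
  suffices h : ((KTilde.toKQuot (m + 1) (m + 1)).comp (Distr.eval f))
      (∑ i : Fin (m + 2), (-1 : ℤ) ^ (i : ℕ) • translate μ (fun j => l (i.succAbove j))) = 0 from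
    KTilde.toKQuot_injective _ _ (h.trans (map_zero _).symm)
  rw [map_sum]
  simp only [map_zsmul]
  have hi₀ : i₀ ∈ I := (hmemI i₀).mpr ((hcGP i₀).mp h₀)
  have hLi : LinearIndependent ℚ fun j => L (i₀.succAbove j) :=
    (generalPosition_iff.mp h₀).units_smul
      fun j => Units.mk0 _ (mul_ne_zero hd' (hb0 (i₀.succAbove j)))
  -- The zero on the right becomes the alternating sum of products, and the sums agree term by term.
  -- Outside I the face is degenerate, so its distribution is zero and so is the coefficient.
  rw [← sum_wedge_eq_zero (fun i => (L i a, L i)) I ?_ i₀ hi₀ ?_ hLi]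
  · refine Finset.sum_congr rfl fun i _ => congrArg _ ?_
    by_cases hi : i ∈ I
    · rw [if_pos hi, one_smul]
      exact translate_coset hη hμ ((hcGP i).mpr ((hmemI i).mp hi))
        (fun j => mul_ne_zero hd' (hb0 (i.succAbove j))) (hfi i hi)
    · rw [if_neg hi, zero_smul, translate_of_not μ fun h => hi ((hmemI i).mpr ((hcGP i).mp h)),
        map_zero]
  · refine Prod.ext ?_ ?_
    · rw [Prod.fst_sum]
      have := LinearMap.congr_fun hsumL a
      rwa [LinearMap.sum_apply] at this
    · rw [Prod.snd_sum]
      exact hsumL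
  · intro h
    exact smul_ne_zero (mul_ne_zero hd' (hb0 i₀)) (hl i₀) (congrArg Prod.snd h)

/-! ### The Stevens cocycle -/

theorem boundary_of {n k : ℕ} (σ : Simplex n (k + 1)) :
    boundary n k (FreeAbelianGroup.of σ) =
      ∑ i : Fin (k + 2), (-1 : ℤ) ^ (i : ℕ) • FreeAbelianGroup.of (Simplex.face i σ) :=
  FreeAbelianGroup.lift_apply_of ..

/-- The homomorphism `ξ` with `ξ([λ₀, …, λ_{n-1}])` the translate of `μ` to the basis `λ`. -/
def stevensHom {m : ℕ} {μ : Distr (m + 1) (KTilde (m + 1) (m + 1))}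
    (hη : ∀ (a d : ℚ) (hd : 0 < d),
      η (latticeIndicator a d hd) = Additive.ofMul ⟨coordUnit 0 a d, oneSub_mem _ _⟩)
    (hμ : ∀ fs : Fin (m + 1) → TestFun 1,
      μ (tensor fs) = KTilde.symbol fun i => etaCoord η (fs i) i) :
    Chain (m + 1) m →+ Distr (m + 1) (KTilde (m + 1) (m + 1)) :=
  FreeAbelianGroup.lift (Quotient.lift (fun l : NGTuple (m + 1) m => translate μ l.1) (by
    rintro l l' ⟨b, hb, h⟩
    exact (translate_smul hη hμ l.2 l'.2 (fun i => (hb i).ne') h).symm))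

section

variable {m : ℕ} {μ : Distr (m + 1) (KTilde (m + 1) (m + 1))}
  (hη : ∀ (a d : ℚ) (hd : 0 < d),
    η (latticeIndicator a d hd) = Additive.ofMul ⟨coordUnit 0 a d, oneSub_mem _ _⟩)
  (hμ : ∀ fs : Fin (m + 1) → TestFun 1,
    μ (tensor fs) = KTilde.symbol fun i => etaCoord η (fs i) i)

theorem stevensHom_simplex (l : Fin (m + 1) → Covec (m + 1)) (hl : GeneralPosition l) :
    stevensHom hη hμ (FreeAbelianGroup.of (simplex l hl)) = translate μ l :=
  FreeAbelianGroup.lift_apply_of ..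

theorem isStevens_stevensHom : IsStevens η (stevensHom hη hμ) := by
  intro l hl g hg f fs hf
  rw [stevensHom_simplex]
  exact translate_tensor hμ hg hf

/-- The rule fixes the values only at functions that a frame makes factorisable. Characteristic
functions of cosets of multiples of the dual lattice are of this kind and generate. -/
theorem stevens_unique {ξ ξ' : Chain (m + 1) m →+ Distr (m + 1) (KTilde (m + 1) (m + 1))}
    (h : IsStevens η ξ) (h' : IsStevens η ξ') : ξ' = ξ := by
  refine FreeAbelianGroup.lift_ext _ _ fun σ => ?_
  induction σ using Quotient.inductionOn with
  | h l =>
    obtain ⟨g, hg⟩ := exists_frame l.2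
    refine Distr.ext_coset l.2 fun d hd a f hf => ?_
    have hf' := hf.act_eq_tensor hg fun _ => inv_ne_zero (Nat.cast_ne_zero.mpr hd.ne')
    exact (h' l.1 l.2 g hg f _ hf').trans (h l.1 l.2 g hg f _ hf').symm

theorem stevensHom_act (g : GLQ (m + 1)) (c : Chain (m + 1) m) :
    stevensHom hη hμ (Chain.act g c) <• g = stevensHom hη hμ c := by
  have key : (DistribSMul.toAddMonoidHom _ (MulOpposite.op g)).comp
      ((stevensHom hη hμ).comp (Chain.act g)) = stevensHom hη hμ := by
    refine FreeAbelianGroup.lift_ext _ _ fun σ => ?_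
    induction σ using Quotient.inductionOn with
    | h l =>
      refine Eq.trans ?_ ((translate_act μ g l.1).trans (stevensHom_simplex hη hμ l.1 l.2).symm)
      rw [← stevensHom_simplex hη hμ _ (l.2.act g)]
      rfl
  exact DFunLike.congr_fun key c

theorem stevensHom_boundary (c : Chain (m + 1) (m + 1)) :
    stevensHom hη hμ (boundary (m + 1) m c) = 0 := by
  have key : (stevensHom hη hμ).comp (boundary (m + 1) m) = 0 := by
    refine FreeAbelianGroup.lift_ext _ _ fun σ => ?_
    induction σ using Quotient.inductionOn with
    | h l =>
      refine (congrArg (stevensHom hη hμ) (boundary_of (simplex l.1 l.2))).trans ?_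
      rw [map_sum]
      change _ = (0 : Distr (m + 1) (KTilde (m + 1) (m + 1)))
      have hne : ∀ i, l.1 i ≠ 0 := fun i =>
        (l.2 {i} (by simp)).ne_zero (⟨i, Finset.mem_singleton_self i⟩ : ({i} : Finset _))
      rw [← sum_translate_eq_zero hη hμ l.1 hne]
      refine Finset.sum_congr rfl fun i _ => ?_
      rw [map_zsmul]
      refine congrArg _ ?_
      exact stevensHom_simplex hη hμ _ (l.2.comp (Fin.succAboveEmb i))
  exact DFunLike.congr_fun key c

/-- Both sides have the default value 0 on degenerate tuples, so the relations for `translate` give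
the group cocycle without case distinctions. -/
theorem pullToGroup_stevensHom (l : Covec (m + 1)) (σ : Fin (m + 1) → GLQ (m + 1)) :
    pullToGroup l (stevensHom hη hμ) σ = translate μ fun i => covecAct (σ i) l := by
  by_cases h : GeneralPosition fun i => covecAct (σ i) l
  · rw [pullToGroup, dif_pos h, stevensHom_simplex]
  · rw [pullToGroup, dif_neg h, translate_of_not μ h]

theorem pullToGroup_stevensHom_mem {l : Covec (m + 1)} (hl : l ≠ 0) :
    pullToGroup l (stevensHom hη hμ) ∈
      HomCocycle (GLQ (m + 1)) (Distr (m + 1) (KTilde (m + 1) (m + 1))) m := by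
  refine AddSubgroup.mem_inf.mpr ⟨fun g σ => ?_, ?_⟩
  · simp only [pullToGroup_stevensHom, covecAct_mul]
    exact translate_act μ g _
  · refine AddMonoidHom.mem_ker.mpr (funext fun σ => ?_)
    change ∑ i : Fin (m + 2), (-1 : ℤ) ^ (i : ℕ) •
      pullToGroup l (stevensHom hη hμ) (fun j => σ (i.succAbove j)) = 0
    simp only [pullToGroup_stevensHom]
    exact sum_translate_eq_zero hη hμ (fun i => covecAct (σ i) l)
      fun i => covecAct_ne_zero _ l hl

end

end

end StevensCocycle

open StevensCocycle
/-- The main theorem for `V = ℚⁿ`, where `n = m + 1 ≥ 1`. -/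
theorem mainTheorem1 (m : ℕ) :
    ∃ η : Distr 1 (Additive (CGroup 1)), IsKubotaLeopoldt η ∧
      ∃ ξ : Chain (m + 1) m →+ Distr (m + 1) (KTilde (m + 1) (m + 1)),
        -- `ξ` is well defined: it obeys the defining rule, and is the only homomorphism to do so
        IsStevens η ξ ∧ (∀ ξ', IsStevens η ξ' → ξ' = ξ) ∧
        -- invariance under `GL_n(ℚ)`
        (∀ (g : GLQ (m + 1)) (c : Chain (m + 1) m), ξ (Chain.act g c) <• g = ξ c) ∧
        -- the cocycle property
        (∀ c : Chain (m + 1) (m + 1), ξ (boundary (m + 1) m c) = 0) ∧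
        -- the pullback along `λ = e_1^*` is a homogeneous cocycle `Φ` and has a class `[Φ]`
        ∃ c : GroupCohomology (GLQ (m + 1)) (Distr (m + 1) (KTilde (m + 1) (m + 1))) m,
          ∃ Φ : HomCocycle (GLQ (m + 1)) (Distr (m + 1) (KTilde (m + 1) (m + 1))) m,
            c = QuotientAddGroup.mk Φ ∧ Φ.1 = pullToGroup (LinearMap.proj 0) ξ := by
  obtain ⟨η, hη⟩ := exists_kubotaLeopoldt
  obtain ⟨μ, hμ⟩ := exists_stevens_standard hη (m + 1)
  exact ⟨η, isKubotaLeopoldt_of_apply hη, stevensHom hη hμ, isStevens_stevensHom hη hμ,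
    fun ξ' h' => stevens_unique (isStevens_stevensHom hη hμ) h', stevensHom_act hη hμ,
    stevensHom_boundary hη hμ, _,
    ⟨_, pullToGroup_stevensHom_mem hη hμ (proj_ne_zero 0)⟩, rfl, rfl⟩
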